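/- Let $0<L<\infty$, $\lambda_1,\lambda_2>0$, and let $\mu_1,\mu_2:[0,L)\to[0,\infty)$ be measurable functions such that, for $i=1,2$, $\int_0^l\mu_i\,dx<\infty$ for all $0<l<L$, $\int_0^L\mu_i\,dx=\infty$, and, for some positive integer $N$, the limit $\lim_{x\to L^-}\mu_i(x)(L-x)^N$ exists and is finite. Let $X=\mathbb{R}\times L^1(0,L)\times L^1(0,L)$ (real-valued functions) with norm $\|(p_0,p_1,p_2)\|_X=|p_0|+\|p_1\|_{L^1(0,L)}+\|p_2\|_{L^1(0,L)}$ and the componentwise (almost everywhere) order. Define the operator $\mathcal{A}:\mathcal{D}(\mathcal{A})\subset X\to X$ by $$\mathcal{A}(p_0,p_1,p_2)=\Big(-(\lambda_1+\lambda_2)p_0+\int_0^L\mu_1p_1\,dx+\int_0^L\mu_2p_2\,dx,\ -p_1'-(\mu_1+\lambda_2)p_1,\ -p_2'-\mu_2p_2\Big),$$ with domain $$\mathcal{D}(\mathcal{A})=\Big\{(p_0,p_1,p_2)\in X:\ p_i\in W^{1,1}(0,L),\ \mu_ip_i\in L^1(0,L)\ (i=1,2),\ p_1(0)=\lambda_1p_0,\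 p_2(0)=\lambda_2p_0+\lambda_2\int_0^Lp_1\,dx\Big\},$$ where $p_i'$ is the weak derivative and $p_i(0)$ is the value at $0$ of the representative of $p_i$ that is continuous on $[0,L]$. Then $\mathcal{A}$ with domain $\mathcal{D}(\mathcal{A})$ is the infinitesimal generator of a $C_0$-semigroup $(\mathcal{T}(t))_{t\ge0}$ of bounded linear operators on $X$ such that, for every $t\ge0$, $\|\mathcal{T}(t)\|\le1$, and $\mathcal{T}(t)p\ge0$ for all $p\in X$ with $p\ge0$. -/

import Mathlib

open MeasureTheory Set Filter Topology
open scoped ContDiff NNReal ENNReal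

noncomputable section

/-! ### Strongly continuous semigroups and their generators -/

/-- A `C₀`-semigroup of bounded linear operators on a real normed space. -/
structure C0Semigroup (X : Type*) [NormedAddCommGroup X] [NormedSpace ℝ X] where
  /-- The operator at time `t ≥ 0`. -/
  op : ℝ≥0 → X →L[ℝ] X
  op_zero : op 0 = ContinuousLinearMap.id ℝ X
  op_add : ∀ s t : ℝ≥0, op (s + t) = (op s).comp (op t)
  tendsto_zero : ∀ x : X, Tendsto (fun t : ℝ≥0 => op t x) (𝓝 0) (𝓝 x)

namespace C0Semigroup

variable {X : Type*} [NormedAddCommGroup X] [NormedSpace ℝ X]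

/-- `y` is the right derivative at `t = 0` of the orbit `t ↦ T(t) x`. -/
def HasOrbitDeriv (T : C0Semigroup X) (x y : X) : Prop :=
  Tendsto (fun t : ℝ≥0 => (t : ℝ)⁻¹ • (T.op t x - x)) (𝓝[>] 0) (𝓝 y)

theorem HasOrbitDeriv.unique {T : C0Semigroup X} {x y z : X}
    (hy : T.HasOrbitDeriv x y) (hz : T.HasOrbitDeriv x z) : y = z :=
  tendsto_nhds_unique hy hz

theorem HasOrbitDeriv.add {T : C0Semigroup X} {x x' y y' : X}
    (h : T.HasOrbitDeriv x y) (h' : T.HasOrbitDeriv x' y') :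
    T.HasOrbitDeriv (x + x') (y + y') := by
  refine (Tendsto.add h h').congr fun t => ?_
  rw [map_add, ← smul_add]
  congr 1
  abel

theorem HasOrbitDeriv.smul {T : C0Semigroup X} {x y : X} (c : ℝ)
    (h : T.HasOrbitDeriv x y) : T.HasOrbitDeriv (c • x) (c • y) := by
  refine (Tendsto.const_smul h c).congr fun t => ?_
  rw [map_smul, ← smul_sub, smul_comm]

/-- The infinitesimal generator: its domain consists of all `x` for which
`lim_{t → 0+} (T(t) x - x) / t` exists, and its value at `x` is that limit. -/
def generator (T : C0Semigroup X) : X →ₗ.[ℝ] X where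
  domain :=
    { carrier := {x | ∃ y, T.HasOrbitDeriv x y}
      add_mem' := fun ⟨y, hy⟩ ⟨z, hz⟩ => ⟨y + z, hy.add hz⟩
      zero_mem' := ⟨0, by simp [HasOrbitDeriv]⟩
      smul_mem' := fun c _ ⟨y, hy⟩ => ⟨c • y, hy.smul c⟩ }
  toFun :=
    { toFun := fun x => x.2.choose
      map_add' := fun x x' =>
        (x + x').2.choose_spec.unique (x.2.choose_spec.add x'.2.choose_spec)
      map_smul' := fun c x => (c • x).2.choose_spec.unique (x.2.choose_spec.smul c) }

end C0Semigroup

namespace RepairableSystem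

/-! ### The function spaces -/

/-- `L¹(0, L)`. -/
abbrev L1 (L : ℝ) : Type := Lp ℝ 1 (volume.restrict (Ioo 0 L))

/-- `X = ℝ × L¹(0, L) × L¹(0, L)` with the norm `|p₀| + ‖p₁‖ + ‖p₂‖`. The components of
`p : StateSpace L` are `p.fst`, `p.snd.fst` and `p.snd.snd`. -/
abbrev StateSpace (L : ℝ) : Type := WithLp 1 (ℝ × WithLp 1 (L1 L × L1 L))

/-- The element `(p₀, p₁, p₂)` of `X`. -/
def StateSpace.mk {L : ℝ} (p₀ : ℝ) (p₁ p₂ : L1 L) : StateSpace L :=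
  WithLp.toLp 1 (p₀, WithLp.toLp 1 (p₁, p₂))

theorem StateSpace.mk_eq_add {L : ℝ} {a b c : ℝ} {f g h f' g' h' : L1 L} (e : a = b + c)
    (e₁ : f = g + h) (e₂ : f' = g' + h') : mk a f f' = mk b g g' + mk c h h' := by
  subst e e₁ e₂
  rfl

theorem StateSpace.mk_eq_smul {L : ℝ} {a b c : ℝ} {f g f' g' : L1 L} (e : a = c * b)
    (e₁ : f = c • g) (e₂ : f' = c • g') : mk a f f' = c • mk b g g' := by
  subst e e₁ e₂
  rfl

/-- The positive cone of `X`: all components are nonnegative (almost everywhere). -/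
def StateSpace.Nonneg {L : ℝ} (p : StateSpace L) : Prop :=
  0 ≤ p.fst ∧ 0 ≤ p.snd.fst ∧ 0 ≤ p.snd.snd

/-! ### Weak derivatives, `W^{1,1}(0, L)` and boundary values -/

/-- `g` is the weak derivative of `f` on `(0, L)`. -/
def IsWeakDeriv {L : ℝ} (f g : L1 L) : Prop :=
  ∀ φ : ℝ → ℝ, ContDiff ℝ ∞ φ → HasCompactSupport φ → tsupport φ ⊆ Ioo 0 L →
    ∫ x in Ioo 0 L, f x * deriv φ x = -∫ x in Ioo 0 L, g x * φ x

theorem integrable_mul_of_continuous {L : ℝ} (f : L1 L) {φ : ℝ → ℝ} (hφ : Continuous φ)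
    (hs : HasCompactSupport φ) :
    Integrable (fun x => f x * φ x) (volume.restrict (Ioo 0 L)) := by
  obtain ⟨C, hC⟩ := hs.exists_bound_of_continuous hφ
  exact (L1.integrable_coeFn f).mul_bdd hφ.aestronglyMeasurable (Eventually.of_forall hC)

theorem integral_add_mul {L : ℝ} (f f' : L1 L) {φ : ℝ → ℝ} (hφ : Continuous φ)
    (hs : HasCompactSupport φ) :
    ∫ x in Ioo 0 L, (f + f' : L1 L) x * φ x =
      (∫ x in Ioo 0 L, f x * φ x) + ∫ x in Ioo 0 L, f' x * φ x := by
  rw [← integral_add (integrable_mul_of_continuous f hφ hs)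
    (integrable_mul_of_continuous f' hφ hs)]
  refine integral_congr_ae ?_
  filter_upwards [Lp.coeFn_add f f'] with x hx
  rw [hx, Pi.add_apply, add_mul]

theorem integral_smul_mul {L : ℝ} (c : ℝ) (f : L1 L) (φ : ℝ → ℝ) :
    ∫ x in Ioo 0 L, (c • f : L1 L) x * φ x = c * ∫ x in Ioo 0 L, f x * φ x := by
  rw [← integral_const_mul]
  refine integral_congr_ae ?_
  filter_upwards [Lp.coeFn_smul c f] with x hx
  rw [hx, Pi.smul_apply, smul_eq_mul, mul_assoc]

theorem IsWeakDeriv.add {L : ℝ} {f f' g g' : L1 L} (h : IsWeakDeriv f g)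
    (h' : IsWeakDeriv f' g') : IsWeakDeriv (f + f') (g + g') := by
  intro φ hφ hs ht
  rw [integral_add_mul f f' (hφ.continuous_deriv (by simp)) hs.deriv,
    integral_add_mul g g' hφ.continuous hs, h φ hφ hs ht, h' φ hφ hs ht, neg_add]

theorem IsWeakDeriv.smul {L : ℝ} {f g : L1 L} (c : ℝ) (h : IsWeakDeriv f g) :
    IsWeakDeriv (c • f) (c • g) := by
  intro φ hφ hs ht
  rw [integral_smul_mul, integral_smul_mul, h φ hφ hs ht, mul_neg]

theorem isWeakDeriv_zero (L : ℝ) : IsWeakDeriv (0 : L1 L) 0 := by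
  intro φ _ _ _
  have h := fun ψ => integral_smul_mul 0 (0 : L1 L) ψ
  simp only [zero_smul, zero_mul] at h
  rw [h, h, neg_zero]

theorem IsWeakDeriv.unique {L : ℝ} {f g g' : L1 L} (h : IsWeakDeriv f g)
    (h' : IsWeakDeriv f g') : g = g' := by
  have key : ∀ᵐ x ∂volume, x ∈ Ioo 0 L → g x - g' x = 0 := by
    refine isOpen_Ioo.ae_eq_zero_of_integral_contDiff_smul_eq_zero ?_ ?_
    · have hi : IntegrableOn (fun x => g x - g' x) (Ioo 0 L) volume :=
        (L1.integrable_coeFn g).sub (L1.integrable_coeFn g')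
      exact hi.locallyIntegrableOn
    · intro φ hφ hs ht
      have e : ∫ x, φ x • (g x - g' x) = ∫ x in Ioo 0 L, φ x • (g x - g' x) := by
        refine (setIntegral_eq_integral_of_forall_compl_eq_zero fun x hx => ?_).symm
        rw [image_eq_zero_of_notMem_tsupport fun hx' => hx (ht hx'), zero_smul]
      have e' : ∫ x in Ioo 0 L, φ x • (g x - g' x) =
          (∫ x in Ioo 0 L, g x * φ x) - ∫ x in Ioo 0 L, g' x * φ x := by
        rw [← integral_sub (integrable_mul_of_continuous g hφ.continuous hs)
          (integrable_mul_of_continuous g' hφ.continuous hs)]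
        congr 1
        ext x
        simp only [smul_eq_mul]
        ring
      rw [e, e']
      linarith [h φ hφ hs ht, h' φ hφ hs ht]
  refine Lp.ext ?_
  filter_upwards [(ae_restrict_iff' measurableSet_Ioo).2 key] with x hx
  exact sub_eq_zero.1 hx

/-- The weak derivative `d/dx` on `L¹(0, L)`; its domain is `W^{1,1}(0, L)`, the functions in
`L¹(0, L)` that have a weak derivative in `L¹(0, L)`. -/
def weakDeriv (L : ℝ) : L1 L →ₗ.[ℝ] L1 L where
  domain :=
    { carrier := {f | ∃ g, IsWeakDeriv f g}
      add_mem' := fun ⟨g, hg⟩ ⟨g', hg'⟩ => ⟨g + g', hg.add hg'⟩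
      zero_mem' := ⟨0, isWeakDeriv_zero L⟩
      smul_mem' := fun c _ ⟨g, hg⟩ => ⟨c • g, hg.smul c⟩ }
  toFun :=
    { toFun := fun f => f.2.choose
      map_add' := fun f f' =>
        (f + f').2.choose_spec.unique (f.2.choose_spec.add f'.2.choose_spec)
      map_smul' := fun c f => (c • f).2.choose_spec.unique (f.2.choose_spec.smul c) }

/-- The Sobolev space `W^{1,1}(0, L)`. -/
abbrev W11 (L : ℝ) : Submodule ℝ (L1 L) := (weakDeriv L).domain

/-- `f(0) = a`, where `f(0)` is the value at `0` of the representative of `f` that is continuous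
on `[0, L]`. -/
def HasValueAtZero {L : ℝ} (f : L1 L) (a : ℝ) : Prop :=
  ∃ F : ℝ → ℝ, ContinuousOn F (Icc 0 L) ∧ f =ᵐ[volume.restrict (Ioo 0 L)] F ∧ F 0 = a

theorem HasValueAtZero.add {L : ℝ} {f f' : L1 L} {a a' : ℝ} (h : HasValueAtZero f a)
    (h' : HasValueAtZero f' a') : HasValueAtZero (f + f') (a + a') := by
  obtain ⟨F, hF, hfF, rfl⟩ := h
  obtain ⟨F', hF', hfF', rfl⟩ := h'
  exact ⟨F + F', hF.add hF', (Lp.coeFn_add f f').trans (hfF.add hfF'), rfl⟩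

theorem HasValueAtZero.smul {L : ℝ} {f : L1 L} {a : ℝ} (c : ℝ) (h : HasValueAtZero f a) :
    HasValueAtZero (c • f) (c * a) := by
  obtain ⟨F, hF, hfF, rfl⟩ := h
  exact ⟨c • F, hF.const_smul c, (Lp.coeFn_smul c f).trans (hfF.const_smul c), rfl⟩

theorem HasValueAtZero.of_eq {L : ℝ} {f : L1 L} {a b : ℝ} (h : HasValueAtZero f a)
    (e : a = b) : HasValueAtZero f b := e ▸ h

theorem hasValueAtZero_zero (L : ℝ) : HasValueAtZero (0 : L1 L) 0 :=
  ⟨0, continuousOn_const, Lp.coeFn_zero _ _ _, rfl⟩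

/-! ### Multiplication by a repair rate -/

theorem mul_add_ae {L : ℝ} (μ : ℝ → ℝ) (f f' : L1 L) :
    (fun x => μ x * f x + μ x * f' x) =ᵐ[volume.restrict (Ioo 0 L)]
      fun x => μ x * (f + f' : L1 L) x := by
  filter_upwards [Lp.coeFn_add f f'] with x hx
  rw [hx, Pi.add_apply, mul_add]

theorem mul_smul_ae {L : ℝ} (μ : ℝ → ℝ) (c : ℝ) (f : L1 L) :
    (fun x => c * (μ x * f x)) =ᵐ[volume.restrict (Ioo 0 L)]
      fun x => μ x * (c • f : L1 L) x := by
  filter_upwards [Lp.coeFn_smul c f] with x hx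
  rw [hx, Pi.smul_apply, smul_eq_mul, mul_left_comm]

theorem toL1_mul_add {L : ℝ} (μ : ℝ → ℝ) (f f' : L1 L)
    (h : Integrable (fun x => μ x * f x) (volume.restrict (Ioo 0 L)))
    (h' : Integrable (fun x => μ x * f' x) (volume.restrict (Ioo 0 L)))
    (h'' : Integrable (fun x => μ x * (f + f' : L1 L) x) (volume.restrict (Ioo 0 L))) :
    h''.toL1 _ = h.toL1 _ + h'.toL1 _ := by
  refine Lp.ext ?_
  filter_upwards [h''.coeFn_toL1, h.coeFn_toL1, h'.coeFn_toL1, mul_add_ae μ f f',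
    Lp.coeFn_add (h.toL1 _) (h'.toL1 _)] with x h1 h2 h3 h4 h5
  rw [h5, Pi.add_apply, h1, h2, h3, h4]

theorem toL1_mul_smul {L : ℝ} (μ : ℝ → ℝ) (c : ℝ) (f : L1 L)
    (h : Integrable (fun x => μ x * f x) (volume.restrict (Ioo 0 L)))
    (h' : Integrable (fun x => μ x * (c • f : L1 L) x) (volume.restrict (Ioo 0 L))) :
    h'.toL1 _ = c • h.toL1 _ := by
  refine Lp.ext ?_
  filter_upwards [h'.coeFn_toL1, h.coeFn_toL1, mul_smul_ae μ c f,
    Lp.coeFn_smul c (h.toL1 _)] with x h1 h2 h3 h4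
  rw [h4, Pi.smul_apply, h1, h2, smul_eq_mul, h3]

/-- All `f ∈ L¹(0, L)` with `μ f ∈ L¹(0, L)`. -/
def mulDomain (L : ℝ) (μ : ℝ → ℝ) : Submodule ℝ (L1 L) where
  carrier := {f | Integrable (fun x => μ x * f x) (volume.restrict (Ioo 0 L))}
  add_mem' := fun {f f'} hf hf' => (Integrable.add hf hf').congr (mul_add_ae μ f f')
  zero_mem' := by
    refine (integrable_zero ℝ ℝ _).congr ?_
    filter_upwards [Lp.coeFn_zero ℝ 1 (volume.restrict (Ioo 0 L))] with x hx
    rw [hx, Pi.zero_apply, mul_zero]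
  smul_mem' := fun c f hf => (Integrable.const_mul hf c).congr (mul_smul_ae μ c f)

theorem mem_mulDomain {L : ℝ} {μ : ℝ → ℝ} {f : L1 L} :
    f ∈ mulDomain L μ ↔ Integrable (fun x => μ x * f x) (volume.restrict (Ioo 0 L)) :=
  Iff.rfl

/-- Multiplication by `μ`, on the domain of all `f ∈ L¹(0, L)` with `μ f ∈ L¹(0, L)`. -/
def mulOp (L : ℝ) (μ : ℝ → ℝ) : L1 L →ₗ.[ℝ] L1 L where
  domain := mulDomain L μ
  toFun :=
    { toFun := fun f => (mem_mulDomain.1 f.2).toL1 _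
      map_add' := fun f f' => toL1_mul_add μ f.1 f'.1 (mem_mulDomain.1 f.2)
        (mem_mulDomain.1 f'.2) (mem_mulDomain.1 (f + f').2)
      map_smul' := fun c f => toL1_mul_smul μ c f.1 (mem_mulDomain.1 f.2)
        (mem_mulDomain.1 (c • f).2) }

theorem integral_mul_add {L : ℝ} {μ : ℝ → ℝ} {f f' : L1 L} (h : f ∈ mulDomain L μ)
    (h' : f' ∈ mulDomain L μ) :
    ∫ x in Ioo 0 L, μ x * (f + f' : L1 L) x =
      (∫ x in Ioo 0 L, μ x * f x) + ∫ x in Ioo 0 L, μ x * f' x := by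
  rw [← integral_add h h']
  exact (integral_congr_ae (mul_add_ae μ f f')).symm

theorem integral_mul_smul {L : ℝ} (μ : ℝ → ℝ) (c : ℝ) (f : L1 L) :
    ∫ x in Ioo 0 L, μ x * (c • f : L1 L) x = c * ∫ x in Ioo 0 L, μ x * f x := by
  rw [← integral_const_mul]
  exact (integral_congr_ae (mul_smul_ae μ c f)).symm

/-! ### The system operator -/

/-- The standing assumptions on a repair rate `μ` on `[0, L)`: it is nonnegative, integrable over
`(0, l)` for every `l < L`, not integrable over `(0, L)`, and `μ(x) (L - x)^N` has a finite limit
as `x → L`. -/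
structure IsRepairRate (L : ℝ) (N : ℕ) (μ : ℝ → ℝ) : Prop where
  nonneg : ∀ x ∈ Ico 0 L, 0 ≤ μ x
  integrableOn : ∀ l, 0 < l → l < L → IntegrableOn μ (Ioo 0 l)
  lintegral_eq_top : ∫⁻ x in Ioo 0 L, ENNReal.ofReal (μ x) = ⊤
  tendsto : ∃ c : ℝ, Tendsto (fun x => μ x * (L - x) ^ N) (𝓝[<] L) (𝓝 c)

/-- `D(𝒜)`: all `(p₀, p₁, p₂) ∈ X` with `pᵢ ∈ W^{1,1}(0, L)`, `μᵢ pᵢ ∈ L¹(0, L)`,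
`p₁(0) = lam₁ p₀` and `p₂(0) = lam₂ p₀ + lam₂ ∫₀ᴸ p₁ dx`. -/
def systemDomain (L lam₁ lam₂ : ℝ) (μ₁ μ₂ : ℝ → ℝ) : Submodule ℝ (StateSpace L) where
  carrier := {p | (p.snd.fst ∈ W11 L ∧ p.snd.snd ∈ W11 L) ∧
    (p.snd.fst ∈ mulDomain L μ₁ ∧ p.snd.snd ∈ mulDomain L μ₂) ∧
    HasValueAtZero p.snd.fst (lam₁ * p.fst) ∧
    HasValueAtZero p.snd.snd (lam₂ * p.fst + lam₂ * ∫ x in Ioo 0 L, p.snd.fst x)}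
  add_mem' := by
    rintro p q ⟨⟨h₁, h₂⟩, ⟨h₃, h₄⟩, h₅, h₆⟩ ⟨⟨k₁, k₂⟩, ⟨k₃, k₄⟩, k₅, k₆⟩
    refine ⟨⟨add_mem h₁ k₁, add_mem h₂ k₂⟩, ⟨add_mem h₃ k₃, add_mem h₄ k₄⟩, ?_, ?_⟩
    · refine (h₅.add k₅).of_eq ?_
      rw [WithLp.add_fst]
      ring
    · refine (h₆.add k₆).of_eq ?_
      have e : ∫ x in Ioo 0 L, (p + q).snd.fst x =
          (∫ x in Ioo 0 L, p.snd.fst x) + ∫ x in Ioo 0 L, q.snd.fst x := by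
        rw [← integral_add (L1.integrable_coeFn _) (L1.integrable_coeFn _)]
        exact integral_congr_ae (Lp.coeFn_add p.snd.fst q.snd.fst)
      rw [e, WithLp.add_fst]
      ring
  zero_mem' := by
    have e : ∫ x in Ioo 0 L, (0 : L1 L) x = 0 := by
      rw [integral_congr_ae (Lp.coeFn_zero ℝ 1 (volume.restrict (Ioo 0 L)))]
      exact integral_zero _ _
    refine ⟨⟨zero_mem _, zero_mem _⟩, ⟨zero_mem _, zero_mem _⟩, ?_, ?_⟩
    · change HasValueAtZero (0 : L1 L) (lam₁ * 0)
      rw [mul_zero]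
      exact hasValueAtZero_zero L
    · change HasValueAtZero (0 : L1 L) (lam₂ * 0 + lam₂ * ∫ x in Ioo 0 L, (0 : L1 L) x)
      rw [e, mul_zero, add_zero]
      exact hasValueAtZero_zero L
  smul_mem' := by
    rintro c p ⟨⟨h₁, h₂⟩, ⟨h₃, h₄⟩, h₅, h₆⟩
    refine ⟨⟨Submodule.smul_mem _ c h₁, Submodule.smul_mem _ c h₂⟩,
      ⟨Submodule.smul_mem _ c h₃, Submodule.smul_mem _ c h₄⟩, ?_, ?_⟩
    · refine (h₅.smul c).of_eq ?_
      rw [WithLp.smul_fst, smul_eq_mul]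
      ring
    · refine (h₆.smul c).of_eq ?_
      have e : ∫ x in Ioo 0 L, (c • p).snd.fst x = c * ∫ x in Ioo 0 L, p.snd.fst x := by
        rw [← integral_const_mul]
        exact integral_congr_ae (Lp.coeFn_smul c p.snd.fst)
      rw [e, WithLp.smul_fst, smul_eq_mul]
      ring

/-- The system operator
`𝒜 (p₀, p₁, p₂) = (-(lam₁ + lam₂) p₀ + ∫₀ᴸ μ₁ p₁ dx + ∫₀ᴸ μ₂ p₂ dx,
-(p₁' + μ₁ p₁ + lam₂ p₁), -(p₂' + μ₂ p₂))` with domain `D(𝒜)`. -/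
def systemOperator (L lam₁ lam₂ : ℝ) (μ₁ μ₂ : ℝ → ℝ) : StateSpace L →ₗ.[ℝ] StateSpace L where
  domain := systemDomain L lam₁ lam₂ μ₁ μ₂
  toFun :=
    { toFun := fun p =>
        StateSpace.mk
          (-(lam₁ + lam₂) * p.1.fst + (∫ x in Ioo 0 L, μ₁ x * p.1.snd.fst x)
            + ∫ x in Ioo 0 L, μ₂ x * p.1.snd.snd x)
          (-(weakDeriv L ⟨p.1.snd.fst, p.2.1.1⟩ + mulOp L μ₁ ⟨p.1.snd.fst, p.2.2.1.1⟩
            + lam₂ • p.1.snd.fst))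
          (-(weakDeriv L ⟨p.1.snd.snd, p.2.1.2⟩ + mulOp L μ₂ ⟨p.1.snd.snd, p.2.2.1.2⟩))
      map_add' := fun p q => by
        have d₁ := (weakDeriv L).map_add ⟨p.1.snd.fst, p.2.1.1⟩ ⟨q.1.snd.fst, q.2.1.1⟩
        have d₂ := (weakDeriv L).map_add ⟨p.1.snd.snd, p.2.1.2⟩ ⟨q.1.snd.snd, q.2.1.2⟩
        have m₁ := (mulOp L μ₁).map_add ⟨p.1.snd.fst, p.2.2.1.1⟩ ⟨q.1.snd.fst, q.2.2.1.1⟩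
        have m₂ := (mulOp L μ₂).map_add ⟨p.1.snd.snd, p.2.2.1.2⟩ ⟨q.1.snd.snd, q.2.2.1.2⟩
        have i₁ := integral_mul_add p.2.2.1.1 q.2.2.1.1
        have i₂ := integral_mul_add p.2.2.1.2 q.2.2.1.2
        refine StateSpace.mk_eq_add ?_ ?_ ?_
        · change -(lam₁ + lam₂) * (p.1.fst + q.1.fst)
            + (∫ x in Ioo 0 L, μ₁ x * (p.1.snd.fst + q.1.snd.fst : L1 L) x)
            + (∫ x in Ioo 0 L, μ₂ x * (p.1.snd.snd + q.1.snd.snd : L1 L) x) = _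
          rw [i₁, i₂]
          ring
        · refine (congrArg₂ (fun a b => -(a + b + lam₂ • (p.1.snd.fst + q.1.snd.fst)))
            d₁ m₁).trans ?_
          rw [smul_add]
          abel
        · refine (congrArg₂ (fun a b => -(a + b)) d₂ m₂).trans ?_
          abel
      map_smul' := fun c p => by
        rw [RingHom.id_apply]
        have d₁ := (weakDeriv L).map_smul c ⟨p.1.snd.fst, p.2.1.1⟩
        have d₂ := (weakDeriv L).map_smul c ⟨p.1.snd.snd, p.2.1.2⟩
        have m₁ := (mulOp L μ₁).map_smul c ⟨p.1.snd.fst, p.2.2.1.1⟩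
        have m₂ := (mulOp L μ₂).map_smul c ⟨p.1.snd.snd, p.2.2.1.2⟩
        have i₁ := integral_mul_smul μ₁ c p.1.snd.fst
        have i₂ := integral_mul_smul μ₂ c p.1.snd.snd
        refine StateSpace.mk_eq_smul ?_ ?_ ?_
        · change -(lam₁ + lam₂) * (c * p.1.fst)
            + (∫ x in Ioo 0 L, μ₁ x * (c • p.1.snd.fst : L1 L) x)
            + (∫ x in Ioo 0 L, μ₂ x * (c • p.1.snd.snd : L1 L) x) = _
          rw [i₁, i₂]
          ring
        · refine (congrArg₂ (fun a b => -(a + b + lam₂ • (c • p.1.snd.fst))) d₁ m₁).trans ?_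
          rw [smul_neg, smul_add, smul_add, smul_comm lam₂ c]
        · refine (congrArg₂ (fun a b => -(a + b)) d₂ m₂).trans ?_
          rw [smul_neg, smul_add] }

end RepairableSystem

end

/-! ### Exponentials of bounded dissipative operators -/

section Exponential

open NormedSpace (exp)

variable {X : Type*} [NormedAddCommGroup X] [NormedSpace ℝ X] [CompleteSpace X]

/-! The proof applies the Hille–Yosida theorem for contractions: it suffices that D(𝒜) is dense,
that γ‖p‖ ≤ ‖(γ - 𝒜)p‖ and γ - 𝒜 is onto for every γ > 0, and that its inverse preserves the closed
positive cone.

Dissipativity expresses conservation of probability. If (γ - 𝒜)p = y, each pᵢ solves a linear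
equation p' + (μ + c)p = yᵢ, and the L¹ estimate ∫μ|p| + c‖p‖ ≤ |p(0)| + ‖yᵢ‖
(`IsSolution.integral_mul_abs_add_le`) bounds what leaves state i by what enters it. When this is
added to the scalar equation for p₀, all failure and repair terms cancel and γ‖p‖ ≤ ‖y‖ remains. The
same estimate on [0, l], uniform in l < L, shows that μp is integrable up to L although μ is not.

For surjectivity, variation of constants solves the two differential equations with p₀ as a
parameter; the boundary conditions and the first component then reduce to one scalar equation κ p₀ =
η. The estimate for the homogeneous solutions gives κ > 0, and for y ≥ 0 every quantity in the
solution is nonnegative (`exists_resolvent`).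

The semigroup is the strong limit of exp(t γₙ(Jₙ - 1)) with Jₙ = γₙ(γₙ - 𝒜)⁻¹. Since Jₙ is a
contraction preserving the cone, so are these exponentials, and both properties survive the limit
(`C0Semigroup.exists_of_dissipative`). -/

theorem ContinuousLinearMap.hasSum_exp_apply (B : X →L[ℝ] X) (x : X) :
    HasSum (fun n : ℕ => ((n.factorial : ℝ)⁻¹) • (B ^ n) x) (exp B x) := by
  have h := NormedSpace.exp_series_hasSum_exp' (𝕂 := ℝ) B
  exact h.mapL (ContinuousLinearMap.apply ℝ X x)

theorem ContinuousLinearMap.exp_smul_sub_one (J : X →L[ℝ] X) (c : ℝ) :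
    exp (c • (J - 1)) = Real.exp (-c) • exp (c • J) := by
  have hc : c • (J - 1) = (c • J) + algebraMap ℝ (X →L[ℝ] X) (-c) := by
    rw [Algebra.algebraMap_eq_smul_one, smul_sub, neg_smul, sub_eq_add_neg]
  rw [hc]
  let _ : NormedAlgebra ℚ (X →L[ℝ] X) := NormedAlgebra.restrictScalars ℚ ℝ (X →L[ℝ] X)
  rw [NormedSpace.exp_add_of_commute (Algebra.commute_algebraMap_right _ _),
    ← NormedSpace.algebraMap_exp_comm, ← Real.exp_eq_exp_ℝ, ← Algebra.commutes,
    ← Algebra.smul_def]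

/-- The exponential is e^{-c} ∑ cⁿ Jⁿ / n!, a Poisson average of the powers of J, each of which is a
contraction. -/
theorem ContinuousLinearMap.norm_exp_smul_sub_one_le {J : X →L[ℝ] X} (hJ : ‖J‖ ≤ 1) {c : ℝ}
    (hc : 0 ≤ c) : ‖exp (c • (J - 1))‖ ≤ 1 := by
  refine ContinuousLinearMap.opNorm_le_bound _ zero_le_one fun x => ?_
  have hpow : ∀ n : ℕ, ‖(J ^ n) x‖ ≤ ‖x‖ := by
    intro n
    induction n with
    | zero => simp
    | succ n ih =>
      rw [pow_succ', mul_apply_eq_comp]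
      exact (J.le_of_opNorm_le hJ _).trans (by rwa [one_mul])
  have hs : HasSum (fun n : ℕ => ((n.factorial : ℝ)⁻¹ * c ^ n) * ‖x‖) (Real.exp c * ‖x‖) := by
    refine HasSum.mul_right _ ?_
    have := NormedSpace.exp_series_hasSum_exp' (𝕂 := ℝ) c
    rwa [← Real.exp_eq_exp_ℝ] at this
  have hle : ‖exp (c • J) x‖ ≤ Real.exp c * ‖x‖ := by
    have h1 := ContinuousLinearMap.hasSum_exp_apply (c • J) x
    rw [← h1.tsum_eq, ← hs.tsum_eq]
    refine tsum_of_norm_bounded hs.summable.hasSum fun n => ?_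
    rw [smul_pow, smul_apply, smul_smul, norm_smul, norm_mul, norm_inv, norm_pow,
      Real.norm_of_nonneg hc, Real.norm_natCast]
    exact mul_le_mul_of_nonneg_left (hpow n) (by positivity)
  rw [ContinuousLinearMap.exp_smul_sub_one, smul_apply, norm_smul,
    Real.norm_of_nonneg (Real.exp_pos _).le]
  calc Real.exp (-c) * ‖exp (c • J) x‖ ≤ Real.exp (-c) * (Real.exp c * ‖x‖) := by gcongr
    _ = 1 * ‖x‖ := by rw [← mul_assoc, ← Real.exp_add]; simp

/-- In the same Poisson series every partial sum is a nonnegative combination of the points Jⁿx of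
K, and K is closed. -/
theorem ContinuousLinearMap.exp_smul_sub_one_mem {J : X →L[ℝ] X} {K : ConvexCone ℝ X}
    (hK : IsClosed (K : Set X)) (h0 : (0 : X) ∈ K) (hJ : ∀ x ∈ K, J x ∈ K) {c : ℝ} (hc : 0 ≤ c)
    {x : X} (hx : x ∈ K) : exp (c • (J - 1)) x ∈ K := by
  have hsmul : ∀ {a : ℝ} {y : X}, 0 ≤ a → y ∈ K → a • y ∈ K := by
    intro a y ha hy
    rcases ha.eq_or_lt with rfl | ha
    · rwa [zero_smul]
    · exact K.smul_mem ha hy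
  have hpow : ∀ n : ℕ, (J ^ n) x ∈ K := by
    intro n
    induction n with
    | zero => simpa
    | succ n ih =>
      rw [pow_succ', mul_apply_eq_comp]
      exact hJ _ ih
  rw [ContinuousLinearMap.exp_smul_sub_one, smul_apply]
  refine hsmul (Real.exp_pos _).le ?_
  refine hK.mem_of_tendsto (ContinuousLinearMap.hasSum_exp_apply (c • J) x)
    (Eventually.of_forall fun s => ?_)
  refine Finset.sum_induction _ (· ∈ K) (fun _ _ ha hb => K.add_mem ha hb) h0 fun n _ => ?_
  rw [smul_pow, smul_apply]
  exact hsmul (by positivity) (hsmul (by positivity) (hpow n))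

/-- The path s ↦ e^{sB} e^{(t-s)C} x joins the two vectors; by commutation its derivative is e^{sB}
e^{(t-s)C}(Bx - Cx), of norm at most ‖Bx - Cx‖. -/
theorem ContinuousLinearMap.norm_exp_sub_exp_apply_le {B C : X →L[ℝ] X} (hBC : Commute B C)
    (hB : ∀ t : ℝ, 0 ≤ t → ‖exp (t • B)‖ ≤ 1) (hC : ∀ t : ℝ, 0 ≤ t → ‖exp (t • C)‖ ≤ 1)
    {t : ℝ} (ht : 0 ≤ t) (x : X) :
    ‖exp (t • B) x - exp (t • C) x‖ ≤ t * ‖B x - C x‖ := by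
  have hd : ∀ s : ℝ, HasDerivAt (fun s : ℝ => exp (s • B) (exp ((t - s) • C) x))
      (exp (s • B) (exp ((t - s) • C) (B x - C x))) s := by
    intro s
    have h1 := hasDerivAt_exp_smul_const (𝕂 := ℝ) B s
    have h2 := (hasDerivAt_exp_smul_const (𝕂 := ℝ) C (t - s)).scomp s
      ((hasDerivAt_id s).const_sub t)
    have h3 := (h1.mul h2).clm_apply (hasDerivAt_const s x)
    have hc : B (exp ((t - s) • C) x) = exp ((t - s) • C) (B x) :=
      DFunLike.congr_fun (hBC.smul_right (t - s)).exp_right.eq x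
    refine h3.congr_deriv ?_
    change exp (s • B) (B (exp ((t - s) • C) x)) +
      exp (s • B) ((-1 : ℝ) • exp ((t - s) • C) (C x)) + exp (s • B) (exp ((t - s) • C) 0) = _
    rw [hc, ← map_add, neg_one_smul, map_zero, map_zero, add_zero, ← sub_eq_add_neg, ← map_sub (exp ((t - s) • C))]
  have := norm_image_sub_le_of_norm_deriv_le_segment' (a := 0) (b := t) (C := ‖B x - C x‖)
    (fun s _ => (hd s).hasDerivWithinAt) (fun s hs => ?_) t ⟨ht, le_rfl⟩
  · simpa [NormedSpace.exp_zero, mul_comm] using this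
  · refine ((exp (s • B)).le_of_opNorm_le (hB s hs.1) _).trans ?_
    rw [one_mul]
    refine ((exp ((t - s) • C)).le_of_opNorm_le (hC _ (by linarith [hs.2])) _).trans ?_
    rw [one_mul]

theorem ContinuousLinearMap.norm_exp_apply_sub_le {B : X →L[ℝ] X}
    (hB : ∀ t : ℝ, 0 ≤ t → ‖exp (t • B)‖ ≤ 1) {t : ℝ} (ht : 0 ≤ t) (x : X) :
    ‖exp (t • B) x - x‖ ≤ t * ‖B x‖ := by
  have h : ∀ t : ℝ, 0 ≤ t → ‖exp (t • (0 : X →L[ℝ] X))‖ ≤ 1 := by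
    intro t _
    rw [smul_zero, NormedSpace.exp_zero]
    exact ContinuousLinearMap.norm_id_le
  simpa [NormedSpace.exp_zero] using
    ContinuousLinearMap.norm_exp_sub_exp_apply_le (Commute.zero_right B) hB h ht x

/-- Mean value inequality for s ↦ e^{sB}x - sBx. It replaces the integral formula for the orbit when
the generator is identified. -/
theorem ContinuousLinearMap.norm_exp_apply_sub_sub_le {B : X →L[ℝ] X} {t : ℝ} (ht : 0 ≤ t)
    {x : X} {C : ℝ} (hC : ∀ s ∈ Ico 0 t, ‖exp (s • B) (B x) - B x‖ ≤ C) :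
    ‖exp (t • B) x - x - t • B x‖ ≤ t * C := by
  have hd : ∀ s : ℝ, HasDerivAt (fun s : ℝ => exp (s • B) x - s • B x)
      (exp (s • B) (B x) - B x) s := by
    intro s
    have h1 := (hasDerivAt_exp_smul_const (𝕂 := ℝ) B s).clm_apply (hasDerivAt_const s x)
    have h2 := (hasDerivAt_id s).smul_const (B x)
    refine (h1.sub h2).congr_deriv ?_
    change exp (s • B) (B x) + exp (s • B) 0 - (1 : ℝ) • B x = _
    rw [map_zero, add_zero, one_smul]
  have := norm_image_sub_le_of_norm_deriv_le_segment' (a := 0) (b := t) (C := C)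
    (fun s _ => (hd s).hasDerivWithinAt) hC t ⟨ht, le_rfl⟩
  rw [sub_right_comm]
  simpa [NormedSpace.exp_zero, mul_comm] using this

end Exponential

/-! ### Generation of contraction semigroups -/

section Generation

open NormedSpace (exp)

variable {X : Type*} [NormedAddCommGroup X] [NormedSpace ℝ X]

/-- `J = γ (γ - A)⁻¹` for the operator `A`, whose Yosida approximation is `γ (J - 1)`. -/
structure LinearPMap.IsScaledResolvent (A : X →ₗ.[ℝ] X) (γ : ℝ) (J : X →L[ℝ] X) : Prop where
  norm_le : ‖J‖ ≤ 1
  mem_domain : ∀ y, J y ∈ A.domain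
  map_eq : ∀ y, A ⟨J y, mem_domain y⟩ = γ • (J y - y)
  apply_map : ∀ x : A.domain, J (A x) = γ • (J x - x)

/-! ### Scaled resolvents of a dissipative operator -/

namespace LinearPMap

theorem eq_of_dissipative {A : X →ₗ.[ℝ] X} {γ : ℝ} (hγ : 0 < γ)
    (hdiss : ∀ x : A.domain, γ * ‖(x : X)‖ ≤ ‖γ • (x : X) - A x‖) {x y : A.domain}
    (h : γ • (x : X) - A x = γ • (y : X) - A y) : x = y := by
  have h1 := hdiss (x - y)
  have h2 : γ • ((x - y : A.domain) : X) - A (x - y) = 0 := by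
    rw [A.map_sub, Submodule.coe_sub, smul_sub, sub_sub_sub_comm, h, sub_self]
  rw [h2, norm_zero] at h1
  have h3 : ‖((x - y : A.domain) : X)‖ ≤ 0 := by
    by_contra! hc
    exact absurd h1 (not_le.2 (mul_pos hγ hc))
  exact sub_eq_zero.1 (Subtype.ext (norm_le_zero_iff.1 h3))

/-- Dissipativity makes the solution R y of γx - Ax = γy unique, so R is linear, and the same
inequality bounds it by ‖y‖. -/
theorem exists_isScaledResolvent {A : X →ₗ.[ℝ] X} {γ : ℝ} (hγ : 0 < γ)
    (hdiss : ∀ x : A.domain, γ * ‖(x : X)‖ ≤ ‖γ • (x : X) - A x‖)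
    (hsurj : ∀ y : X, ∃ x : A.domain, γ • (x : X) - A x = y) :
    ∃ J : X →L[ℝ] X, A.IsScaledResolvent γ J := by
  choose R hR using fun y => hsurj (γ • y)
  have hRu : ∀ {y : X} {x : A.domain}, γ • (x : X) - A x = γ • y → R y = x := fun h =>
    eq_of_dissipative hγ hdiss ((hR _).trans h.symm)
  let J₀ : X →ₗ[ℝ] X :=
    { toFun := fun y => R y
      map_add' := fun y z => by
        rw [hRu (y := y + z) (x := R y + R z), Submodule.coe_add]
        rw [A.map_add, Submodule.coe_add, smul_add, smul_add, add_sub_add_comm, hR, hR]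
      map_smul' := fun c y => by
        rw [hRu (y := c • y) (x := c • R y), Submodule.coe_smul, RingHom.id_apply]
        rw [A.map_smul, Submodule.coe_smul, smul_comm γ c, ← smul_sub, hR, smul_comm] }
  have hJ₀ : ∀ y, ‖J₀ y‖ ≤ 1 * ‖y‖ := fun y => by
    have h := hdiss (R y)
    rw [hR, norm_smul, Real.norm_of_nonneg hγ.le] at h
    rw [one_mul]
    exact le_of_mul_le_mul_left h hγ
  refine ⟨J₀.mkContinuous 1 hJ₀, J₀.mkContinuous_norm_le zero_le_one hJ₀, fun y => (R y).2,
    fun y => ?_, fun x => ?_⟩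
  · change A (R y) = γ • ((R y : X) - y)
    rw [smul_sub, ← hR y, sub_sub_cancel]
  · change (R (A x) : X) = γ • ((R x : X) - x)
    rw [hRu (y := A x) (x := γ • (R x - x)), Submodule.coe_smul, Submodule.coe_sub]
    rw [A.map_smul, A.map_sub, Submodule.coe_smul, Submodule.coe_sub, ← smul_sub]
    congr 1
    have h := hR x
    rw [sub_eq_iff_eq_add] at h
    rw [smul_sub, h]
    abel

variable {A : X →ₗ.[ℝ] X}

theorem IsScaledResolvent.commute {γ δ : ℝ} {J J' : X →L[ℝ] X}
    (h : A.IsScaledResolvent γ J) (h' : A.IsScaledResolvent δ J') (hne : γ ≠ δ) :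
    Commute J J' := by
  -- The scaled resolvent identity: J(A(J'y)) is evaluated once through J and once through A J' =
  -- δ(J' - 1).
  have key : ∀ {γ δ : ℝ} {J J' : X →L[ℝ] X}, A.IsScaledResolvent γ J →
      A.IsScaledResolvent δ J' → ∀ y, (γ - δ) • J (J' y) = γ • J' y - δ • J y := by
    intro γ δ J J' h h' y
    have e := h.apply_map ⟨J' y, h'.mem_domain y⟩
    rw [h'.map_eq, _root_.map_smul, _root_.map_sub] at e
    simp only [smul_sub] at e
    rw [sub_smul, sub_eq_sub_iff_add_eq_add]
    rw [sub_eq_sub_iff_add_eq_add] at e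
    rw [← e, add_comm]
  refine ContinuousLinearMap.ext fun y => ?_
  change J (J' y) = J' (J y)
  have e1 := key h h' y
  have e2 := key h' h y
  refine smul_right_injective X (sub_ne_zero.2 hne) ?_
  change (γ - δ) • J (J' y) = (γ - δ) • J' (J y)
  rw [e1, ← neg_sub δ γ, neg_smul, e2, neg_sub]

/-- On the domain, Jₙz - z = Jₙ(Az)/γₙ tends to 0; density and ‖Jₙ‖ ≤ 1 extend this to every x. -/
theorem IsScaledResolvent.tendsto (hd : Dense (A.domain : Set X)) {γ : ℕ → ℝ}
    (hγ : ∀ n, 0 < γ n) (hlim : Tendsto γ atTop atTop) {J : ℕ → X →L[ℝ] X}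
    (hJ : ∀ n, A.IsScaledResolvent (γ n) (J n)) (x : X) :
    Tendsto (fun n => J n x) atTop (𝓝 x) := by
  rw [Metric.tendsto_atTop]
  intro ε hε
  obtain ⟨z, hz, hxz⟩ := Metric.mem_closure_iff.1 (hd x) (ε / 3) (by positivity)
  have hz' : ∀ n, ‖J n z - z‖ ≤ ‖A ⟨z, hz⟩‖ / γ n := by
    intro n
    have e := (hJ n).apply_map ⟨z, hz⟩
    rw [le_div_iff₀' (hγ n), ← Real.norm_of_nonneg (hγ n).le, ← norm_smul, ← e]
    exact ((J n).le_of_opNorm_le (hJ n).norm_le _).trans_eq (one_mul _)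
  have hlim0 : Tendsto (fun n => ‖A ⟨z, hz⟩‖ / γ n) atTop (𝓝 0) := hlim.const_div_atTop _
  obtain ⟨n₀, hn₀⟩ := eventually_atTop.1 (hlim0.eventually_lt_const (show 0 < ε / 3 by positivity))
  refine ⟨n₀, fun n hn => ?_⟩
  have h1 : ‖J n (x - z)‖ ≤ ‖x - z‖ :=
    ((J n).le_of_opNorm_le (hJ n).norm_le _).trans_eq (one_mul _)
  rw [dist_eq_norm] at hxz ⊢
  have e : J n x - x = J n (x - z) + (J n z - z) - (x - z) := by
    rw [_root_.map_sub]
    abel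
  rw [e]
  have := norm_sub_le (J n (x - z) + (J n z - z)) (x - z)
  have := norm_add_le (J n (x - z)) (J n z - z)
  linarith [hz' n, hn₀ n hn]

end LinearPMap

/-! ### Construction of the semigroup and identification of its generator -/

namespace C0Semigroup

/-- Generators of contraction semigroups are dissipative: replace y by the difference quotient, use
‖T(t)x‖ ≤ ‖x‖, and let t → 0. -/
theorem HasOrbitDeriv.norm_le {T : C0Semigroup X} (hT : ∀ t, ‖T.op t‖ ≤ 1) {x y : X}
    (h : T.HasOrbitDeriv x y) {γ : ℝ} (hγ : 0 < γ) : γ * ‖x‖ ≤ ‖γ • x - y‖ := by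
  have hl : Tendsto (fun t : ℝ≥0 => ‖γ • x - (t : ℝ)⁻¹ • (T.op t x - x)‖) (𝓝[>] 0)
      (𝓝 ‖γ • x - y‖) := (tendsto_const_nhds.sub h).norm
  refine ge_of_tendsto hl ?_
  filter_upwards [self_mem_nhdsWithin] with t ht
  have ht' : (0 : ℝ) < t := NNReal.coe_pos.2 ht
  have e : γ • x - (t : ℝ)⁻¹ • (T.op t x - x) =
      (γ + (t : ℝ)⁻¹) • x - (t : ℝ)⁻¹ • T.op t x := by
    rw [smul_sub, add_smul]
    abel
  have h1 : ‖T.op t x‖ ≤ ‖x‖ := ((T.op t).le_of_opNorm_le (hT t) _).trans_eq (one_mul _)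
  have hi : (0 : ℝ) < (t : ℝ)⁻¹ := inv_pos.2 ht'
  have h2 := norm_sub_norm_le ((γ + (t : ℝ)⁻¹) • x) ((t : ℝ)⁻¹ • T.op t x)
  rw [norm_smul, norm_smul, Real.norm_of_nonneg hi.le, Real.norm_of_nonneg (by positivity)] at h2
  rw [e]
  nlinarith

theorem generator_apply {T : C0Semigroup X} {x y : X} (h : T.HasOrbitDeriv x y)
    (hx : x ∈ T.generator.domain) : T.generator ⟨x, hx⟩ = y :=
  HasOrbitDeriv.unique (Exists.choose_spec hx) h

/-- The generator extends A, γ - generator is injective by dissipativity, and γ - A is already onto;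
hence the extension is not proper. -/
theorem generator_eq {T : C0Semigroup X} (hT : ∀ t, ‖T.op t‖ ≤ 1) {A : X →ₗ.[ℝ] X} {γ : ℝ}
    (hγ : 0 < γ) (hsurj : ∀ y : X, ∃ x : A.domain, γ • (x : X) - A x = y)
    (hA : ∀ x : A.domain, T.HasOrbitDeriv x (A x)) : T.generator = A := by
  have hdom : ∀ x ∈ T.generator.domain, x ∈ A.domain := by
    rintro x ⟨y, hy⟩
    obtain ⟨z, hz⟩ := hsurj (γ • x - y)
    have h : T.HasOrbitDeriv (x - z) (y - A z) := by
      have := hy.add ((hA z).smul (-1))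
      rwa [neg_one_smul, neg_one_smul, ← sub_eq_add_neg, ← sub_eq_add_neg] at this
    have h1 := h.norm_le hT hγ
    have e : γ • (x - (z : X)) - (y - A z) = 0 := by
      rw [smul_sub, sub_sub_sub_comm, hz, sub_self]
    rw [e, norm_zero] at h1
    have h3 : ‖x - (z : X)‖ ≤ 0 := by
      by_contra! hc
      exact absurd h1 (not_le.2 (mul_pos hγ hc))
    rw [sub_eq_zero.1 (norm_le_zero_iff.1 h3)]
    exact z.2
  refine LinearPMap.ext (le_antisymm hdom fun x hx => ⟨_, hA ⟨x, hx⟩⟩) fun x hf hg => ?_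
  exact generator_apply (hA ⟨x, hg⟩) hf

variable [CompleteSpace X]

set_option maxHeartbeats 1000000 in
/-- The Hille–Yosida theorem for contraction semigroups leaving a closed cone invariant. -/
theorem exists_of_dissipative (A : X →ₗ.[ℝ] X) (hd : Dense (A.domain : Set X))
    (hdiss : ∀ γ : ℝ, 0 < γ → ∀ x : A.domain, γ * ‖(x : X)‖ ≤ ‖γ • (x : X) - A x‖)
    (hsurj : ∀ γ : ℝ, 0 < γ → ∀ y : X, ∃ x : A.domain, γ • (x : X) - A x = y)
    (K : ConvexCone ℝ X) (hK : IsClosed (K : Set X)) (h0 : (0 : X) ∈ K)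
    (hpos : ∀ γ : ℝ, 0 < γ → ∀ x : A.domain, γ • (x : X) - A x ∈ K → (x : X) ∈ K) :
    ∃ T : C0Semigroup X, T.generator = A ∧ (∀ t, ‖T.op t‖ ≤ 1) ∧
      ∀ t, ∀ x ∈ K, T.op t x ∈ K := by
  let γ : ℕ → ℝ := fun n => n + 1
  have hγ : ∀ n, 0 < γ n := fun n => n.cast_add_one_pos
  have hγlim : Tendsto γ atTop atTop :=
    tendsto_atTop_add_const_right _ _ tendsto_natCast_atTop_atTop
  choose J hJ using fun n =>
    LinearPMap.exists_isScaledResolvent (hγ n) (hdiss _ (hγ n)) (hsurj _ (hγ n))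
  have hJK : ∀ n, ∀ x ∈ K, J n x ∈ K := by
    intro n x hx
    refine hpos _ (hγ n) ⟨J n x, (hJ n).mem_domain x⟩ ?_
    rw [(hJ n).map_eq, smul_sub, sub_sub_cancel]
    exact K.smul_mem (hγ n) hx
  have hJlim := LinearPMap.IsScaledResolvent.tendsto hd hγ hγlim hJ
  let B : ℕ → X →L[ℝ] X := fun n => γ n • (J n - 1)
  have hBD : ∀ n (x : A.domain), B n x = J n (A x) := fun n x => ((hJ n).apply_map x).symm
  have hBlim : ∀ x : A.domain, Tendsto (fun n => B n x) atTop (𝓝 (A x)) := fun x =>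
    (hJlim (A x)).congr fun n => (hBD n x).symm
  have hBle : ∀ n (x : A.domain), ‖B n x‖ ≤ ‖A x‖ := fun n x => by
    rw [hBD]
    exact ((J n).le_of_opNorm_le (hJ n).norm_le _).trans_eq (one_mul _)
  have hBcomm : ∀ m n, Commute (B m) (B n) := by
    intro m n
    have hc : Commute (J m) (J n) := by
      rcases eq_or_ne m n with rfl | hmn
      · exact Commute.refl _
      · refine (hJ m).commute (hJ n) ?_
        simpa [γ] using hmn
    exact ((hc.sub_left (Commute.one_left _)).sub_right (Commute.one_right _)).smul_left _
      |>.smul_right _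
  have hE : ∀ n (t : ℝ), 0 ≤ t → ‖exp (t • B n)‖ ≤ 1 := by
    intro n t ht
    rw [smul_smul]
    exact ContinuousLinearMap.norm_exp_smul_sub_one_le (hJ n).norm_le (mul_nonneg ht (hγ n).le)
  have hEx : ∀ n (t : ℝ≥0) x, ‖exp ((t : ℝ) • B n) x‖ ≤ ‖x‖ := fun n t x =>
    ((exp ((t : ℝ) • B n)).le_of_opNorm_le (hE n t t.2) x).trans_eq (one_mul _)
  have hcauchy : ∀ (t : ℝ≥0) (x : X), CauchySeq fun n => exp ((t : ℝ) • B n) x := by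
    intro t x
    rw [Metric.cauchySeq_iff]
    intro ε hε
    obtain ⟨z, hz, hxz⟩ := Metric.mem_closure_iff.1 (hd x) (ε / 4) (by positivity)
    rw [dist_eq_norm] at hxz
    have hc := ((hBlim ⟨z, hz⟩).const_smul (t : ℝ)).cauchySeq
    obtain ⟨n₀, hn₀⟩ := Metric.cauchySeq_iff.1 hc (ε / 4) (by positivity)
    refine ⟨n₀, fun m hm n hn => ?_⟩
    have h1 := ContinuousLinearMap.norm_exp_sub_exp_apply_le (hBcomm m n) (hE m) (hE n) t.2 z
    have h2 := hn₀ m hm n hn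
    rw [dist_eq_norm, ← smul_sub, norm_smul, Real.norm_of_nonneg t.coe_nonneg] at h2
    rw [dist_eq_norm]
    have e : exp ((t : ℝ) • B m) x - exp ((t : ℝ) • B n) x =
        (exp ((t : ℝ) • B m) (x - z) - exp ((t : ℝ) • B n) (x - z)) +
        (exp ((t : ℝ) • B m) z - exp ((t : ℝ) • B n) z) := by
      rw [map_sub, map_sub]
      abel
    rw [e]
    have h3 := norm_add_le (exp ((t : ℝ) • B m) (x - z) - exp ((t : ℝ) • B n) (x - z))
      (exp ((t : ℝ) • B m) z - exp ((t : ℝ) • B n) z)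
    have h4 := norm_sub_le (exp ((t : ℝ) • B m) (x - z)) (exp ((t : ℝ) • B n) (x - z))
    have h5 := hEx m t (x - z)
    have h6 := hEx n t (x - z)
    change ‖exp ((t : ℝ) • B m) z - exp ((t : ℝ) • B n) z‖ ≤ (t : ℝ) * ‖B m z - B n z‖ at h1
    change (t : ℝ) * ‖B m z - B n z‖ < ε / 4 at h2
    linarith
  choose S hS using fun t x => cauchySeq_tendsto_of_complete (hcauchy t x)
  have hSu : ∀ {t x y}, Tendsto (fun n => exp ((t : ℝ≥0) • B n) x) atTop (𝓝 y) → S t x = y :=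
    fun h => tendsto_nhds_unique (hS _ _) h
  let S₀ : ℝ≥0 → X →ₗ[ℝ] X := fun t =>
    { toFun := S t
      map_add' := fun x y => hSu <| ((hS t x).add (hS t y)).congr fun n => (map_add _ _ _).symm
      map_smul' := fun c x => hSu <| ((hS t x).const_smul c).congr fun n => (map_smul _ _ _).symm }
  have hS₀ : ∀ t x, ‖S₀ t x‖ ≤ 1 * ‖x‖ := fun t x => by
    rw [one_mul]
    exact le_of_tendsto (hS t x).norm (Eventually.of_forall fun n => hEx n t x)
  let U : ℝ≥0 → X →L[ℝ] X := fun t => (S₀ t).mkContinuous 1 (hS₀ t)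
  have hU : ∀ (t : ℝ≥0) x, Tendsto (fun n => exp ((t : ℝ) • B n) x) atTop (𝓝 (U t x)) := hS
  have hU1 : ∀ t, ‖U t‖ ≤ 1 := fun t => (S₀ t).mkContinuous_norm_le zero_le_one (hS₀ t)
  have hUx : ∀ t x, ‖U t x‖ ≤ ‖x‖ := fun t x => (hS₀ t x).trans_eq (one_mul _)
  have hUD : ∀ (t : ℝ≥0) (x : A.domain), ‖U t x - x‖ ≤ t * ‖A x‖ := fun t x => by
    refine le_of_tendsto ((hU t x).sub_const (x : X)).norm (Eventually.of_forall fun n => ?_)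
    exact (ContinuousLinearMap.norm_exp_apply_sub_le (hE n) t.2 x).trans
      (mul_le_mul_of_nonneg_left (hBle n x) t.2)
  let T : C0Semigroup X :=
    { op := U
      op_zero := by
        ext x
        refine tendsto_nhds_unique (hU 0 x) ?_
        simp [NormedSpace.exp_zero]
      op_add := fun s t => by
        ext x
        refine tendsto_nhds_unique (hU (s + t) x) ?_
        let _ : NormedAlgebra ℚ (X →L[ℝ] X) := NormedAlgebra.restrictScalars ℚ ℝ (X →L[ℝ] X)
        -- Replacing the inner exponential by its limit leaves an error to which only a contraction
        -- is applied, so strong convergence suffices.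
        have e : ∀ n, exp (((s + t : ℝ≥0) : ℝ) • B n) x =
            exp ((s : ℝ) • B n) (exp ((t : ℝ) • B n) x - U t x) + exp ((s : ℝ) • B n) (U t x) := by
          intro n
          rw [NNReal.coe_add, add_smul, NormedSpace.exp_add_of_commute
            (((Commute.refl (B n)).smul_left _).smul_right _), map_sub, sub_add_cancel]
          rfl
        simp only [e]
        rw [ContinuousLinearMap.comp_apply, ← zero_add (U s (U t x))]
        refine Tendsto.add ?_ (hU s (U t x))
        refine squeeze_zero_norm (fun n => hEx n s _) ?_
        exact tendsto_iff_norm_sub_tendsto_zero.1 (hU t x)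
      tendsto_zero := fun x => by
        rw [Metric.tendsto_nhds]
        intro ε hε
        obtain ⟨z, hz, hxz⟩ := Metric.mem_closure_iff.1 (hd x) (ε / 3) (by positivity)
        rw [dist_eq_norm] at hxz
        have hc : Tendsto (fun t : ℝ≥0 => (t : ℝ) * ‖A ⟨z, hz⟩‖) (𝓝 0) (𝓝 0) := by
          have : Continuous fun t : ℝ≥0 => (t : ℝ) * ‖A ⟨z, hz⟩‖ := by fun_prop
          simpa using this.tendsto 0
        filter_upwards [hc.eventually_lt_const (show 0 < ε / 3 by positivity)] with t ht
        have e : U t x - x = U t (x - z) + (U t z - z) - (x - z) := by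
          rw [map_sub]
          abel
        rw [dist_eq_norm, e]
        have h1 := norm_sub_le (U t (x - z) + (U t z - z)) (x - z)
        have h2 := norm_add_le (U t (x - z)) (U t z - z)
        have h3 : ‖U t z - z‖ ≤ t * ‖A ⟨z, hz⟩‖ := hUD t ⟨z, hz⟩
        linarith [hUx t (x - z)] }
  have hgen : ∀ x : A.domain, T.HasOrbitDeriv x (A x) := by
    intro x
    rw [C0Semigroup.HasOrbitDeriv, Metric.tendsto_nhds]
    intro ε hε
    -- Since A x need not lie in the domain, it is approximated by z in the domain, where ‖e^{sBₙ}z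
    -- - z‖ ≤ s‖Az‖ holds uniformly in n. The remainder estimate then passes to the limit n → ∞.
    obtain ⟨z, hz, hxz⟩ := Metric.mem_closure_iff.1 (hd (A x)) (ε / 4) (by positivity)
    rw [dist_eq_norm] at hxz
    have hc : Tendsto (fun t : ℝ≥0 => (t : ℝ) * ‖A ⟨z, hz⟩‖) (𝓝[>] 0) (𝓝 0) := by
      have : Continuous fun t : ℝ≥0 => (t : ℝ) * ‖A ⟨z, hz⟩‖ := by fun_prop
      have h := this.tendsto 0
      simp only [NNReal.coe_zero, zero_mul] at h
      exact h.mono_left nhdsWithin_le_nhds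
    filter_upwards [hc.eventually_lt_const (show 0 < ε / 4 by positivity),
      self_mem_nhdsWithin] with t ht ht0
    have ht' : (0 : ℝ) < t := NNReal.coe_pos.2 ht0
    have hbound : ‖U t x - x - (t : ℝ) • A x‖ ≤ t * (ε / 4 + ε / 4 + ε / 4) := by
      have hl : Tendsto (fun n => ‖exp ((t : ℝ) • B n) x - x - (t : ℝ) • B n x‖) atTop
          (𝓝 ‖U t x - x - (t : ℝ) • A x‖) :=
        (((hU t x).sub_const (x : X)).sub ((hBlim x).const_smul (t : ℝ))).norm
      have hr : Tendsto (fun n => (t : ℝ) * (‖B n x - z‖ + ε / 4 + ‖B n x - z‖)) atTop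
          (𝓝 (t * (‖A x - z‖ + ε / 4 + ‖A x - z‖))) := by
        have h := ((hBlim x).sub_const z).norm
        exact ((h.add_const _).add h).const_mul _
      refine (le_of_tendsto_of_tendsto' hl hr fun n => ?_).trans ?_
      · refine ContinuousLinearMap.norm_exp_apply_sub_sub_le t.2 fun s hs => ?_
        have e : exp (s • B n) (B n x) - B n x =
            exp (s • B n) (B n x - z) + (exp (s • B n) z - z) - (B n x - z) := by
          rw [map_sub]
          abel
        have h1 := norm_sub_le (exp (s • B n) (B n x - z) + (exp (s • B n) z - z)) (B n x - z)
        have h2 := norm_add_le (exp (s • B n) (B n x - z)) (exp (s • B n) z - z)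
        have h3 : ‖exp (s • B n) z - z‖ ≤ s * ‖A ⟨z, hz⟩‖ :=
          (ContinuousLinearMap.norm_exp_apply_sub_le (hE n) hs.1 z).trans
            (mul_le_mul_of_nonneg_left (hBle n ⟨z, hz⟩) hs.1)
        have h4 : s * ‖A ⟨z, hz⟩‖ ≤ t * ‖A ⟨z, hz⟩‖ :=
          mul_le_mul_of_nonneg_right hs.2.le (norm_nonneg _)
        have h5 := hEx n ⟨s, hs.1⟩ (B n x - z)
        change ‖exp (s • B n) (B n x - z)‖ ≤ ‖B n x - z‖ at h5
        rw [e]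
        linarith
      · exact mul_le_mul_of_nonneg_left (by linarith) t.2
    have e : (t : ℝ)⁻¹ • (U t x - x) - A x = (t : ℝ)⁻¹ • (U t x - x - (t : ℝ) • A x) := by
      rw [smul_sub _ (U t x - x), smul_smul, inv_mul_cancel₀ ht'.ne', one_smul]
    change dist ((t : ℝ)⁻¹ • (U t x - x)) (A x) < ε
    rw [dist_eq_norm, e, norm_smul, norm_inv, Real.norm_of_nonneg ht'.le, inv_mul_lt_iff₀ ht']
    refine hbound.trans_lt (mul_lt_mul_of_pos_left (by linarith) ht')
  refine ⟨T, generator_eq hU1 one_pos (hsurj 1 one_pos) hgen, hU1, fun t x hx => ?_⟩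
  refine hK.mem_of_tendsto (hU t x) (Eventually.of_forall fun n => ?_)
  have := ContinuousLinearMap.exp_smul_sub_one_mem hK h0 (hJK n)
    (mul_nonneg t.2 (hγ n).le) hx
  rwa [← smul_smul] at this

end C0Semigroup

end Generation

/-! ### Absolutely continuous functions -/

theorem LipschitzOnWith.comp_absolutelyContinuousOnInterval {X Y : Type*} [PseudoMetricSpace X]
    [PseudoMetricSpace Y] {φ : X → Y} {C : ℝ≥0} {s : Set X} (hφ : LipschitzOnWith C φ s)
    {f : ℝ → X} {a b : ℝ} (hf : AbsolutelyContinuousOnInterval f a b)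
    (hs : MapsTo f (uIcc a b) s) : AbsolutelyContinuousOnInterval (fun x => φ (f x)) a b := by
  have h0 := Tendsto.const_mul (C : ℝ) hf
  rw [mul_zero] at h0
  refine squeeze_zero' (Eventually.of_forall fun E => Finset.sum_nonneg fun _ _ => dist_nonneg)
    ?_ h0
  filter_upwards [mem_inf_of_right (mem_principal_self _)] with E hE
  rw [Finset.mul_sum]
  refine Finset.sum_le_sum fun i hi => ?_
  exact hφ.dist_le_mul _ (hs (hE.1 i hi).1) _ (hs (hE.1 i hi).2)

theorem absolutelyContinuousOnInterval_const_add_integral {g : ℝ → ℝ} {c a b : ℝ}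
    (hg : IntervalIntegrable g volume a b) :
    AbsolutelyContinuousOnInterval (fun x => c + ∫ t in a..x, g t) a b := by
  have hc : AbsolutelyContinuousOnInterval (fun _ : ℝ => c) a b :=
    ((LipschitzWith.const c).lipschitzOnWith (s := uIcc a b)).absolutelyContinuousOnInterval
  exact hc.add (hg.absolutelyContinuousOnInterval_intervalIntegral left_mem_uIcc)

/-- Off the zeros of F the derivative of |F| is sign(F) g; at a zero |F| has a minimum, so d = 0.
This is the pointwise form of multiplying the equation by the sign of F. -/
theorem HasDerivAt.abs_deriv_add_le {F : ℝ → ℝ} {x g d m : ℝ} (hF : HasDerivAt F g x)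
    (hd : HasDerivAt (fun x => |F x|) d x) : d + m * |F x| ≤ |g + m * F x| := by
  rcases lt_trichotomy (F x) 0 with h | h | h
  · have e : (fun x => |F x|) =ᶠ[𝓝 x] fun x => -F x := by
      filter_upwards [hF.continuousAt.eventually_lt_const h] with z hz using abs_of_neg hz
    rw [hd.unique (hF.neg.congr_of_eventuallyEq e), abs_of_neg h]
    linarith [neg_abs_le (g + m * F x)]
  · have : IsLocalMin (fun x => |F x|) x :=
      Eventually.of_forall fun z => by simp [h]
    rw [this.hasDerivAt_eq_zero hd, h]
    simp
  · have e : (fun x => |F x|) =ᶠ[𝓝 x] F := by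
      filter_upwards [hF.continuousAt.eventually_const_lt h] with z hz using abs_of_pos hz
    rw [hd.unique (hF.congr_of_eventuallyEq e), abs_of_pos h]
    exact le_abs_self _

/-- The `L¹` estimate for `F' + m F` with `m ≥ 0`. -/
theorem abs_add_integral_mul_abs_le {F g m : ℝ → ℝ} {l : ℝ} (hl : 0 ≤ l)
    (hg : IntervalIntegrable g volume 0 l)
    (hF : ∀ x ∈ Icc 0 l, F x = F 0 + ∫ t in (0 : ℝ)..x, g t)
    (hm : ∀ x ∈ Ico 0 l, 0 ≤ m x) (hmF : IntervalIntegrable (fun x => m x * F x) volume 0 l) :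
    |F l| + ∫ x in (0 : ℝ)..l, m x * |F x| ≤ |F 0| + ∫ x in (0 : ℝ)..l, |g x + m x * F x| := by
  -- F is controlled only on [0, l]; the globally defined primitive G has derivative g almost
  -- everywhere there.
  set G : ℝ → ℝ := fun x => F 0 + ∫ t in (0 : ℝ)..x, g t with hG
  have hac : AbsolutelyContinuousOnInterval G 0 l :=
    absolutelyContinuousOnInterval_const_add_integral hg
  have habs : AbsolutelyContinuousOnInterval (fun x => |G x|) 0 l :=
    (lipschitzWith_one_norm (E := ℝ)).lipschitzOnWith.comp_absolutelyContinuousOnInterval hac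
      (mapsTo_univ _ _)
  have hmabs : IntervalIntegrable (fun x => m x * |F x|) volume 0 l := by
    refine hmF.abs.congr_ae ?_
    rw [EventuallyEq, uIoc_of_le hl, ← restrict_Ioo_eq_restrict_Ioc,
      ae_restrict_iff' measurableSet_Ioo]
    exact Eventually.of_forall fun x hx => by
      simp only [abs_mul, abs_of_nonneg (hm x ⟨hx.1.le, hx.2⟩)]
  have hint := habs.integral_deriv_eq_sub
  have hG0 : G 0 = F 0 := by simp [hG]
  have hGl : G l = F l := (hF l ⟨hl, le_rfl⟩).symm
  simp only [hG0, hGl] at hint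
  have hle : ∫ x in (0 : ℝ)..l, (deriv (fun x => |G x|) x + m x * |F x|) ≤
      ∫ x in (0 : ℝ)..l, |g x + m x * F x| := by
    refine intervalIntegral.integral_mono_ae_restrict hl
      (habs.intervalIntegrable_deriv.add hmabs) (hg.add hmF).abs ?_
    rw [← restrict_Ioo_eq_restrict_Icc, EventuallyLE, ae_restrict_iff' measurableSet_Ioo]
    filter_upwards [habs.ae_differentiableAt, hg.ae_hasDerivAt_integral] with x h1 h2 hx
    have hx' : x ∈ uIcc 0 l := by
      rw [uIcc_of_le hl]
      exact Ioo_subset_Icc_self hx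
    rw [hF x (Ioo_subset_Icc_self hx)]
    exact HasDerivAt.abs_deriv_add_le (F := G) ((h2 hx' 0 left_mem_uIcc).const_add (F 0))
      (h1 hx').hasDerivAt
  rw [intervalIntegral.integral_add habs.intervalIntegrable_deriv hmabs, hint] at hle
  linarith

/-! ### A linear differential equation with a locally integrable coefficient -/

section LinearODE

variable {m y : ℝ → ℝ} {L : ℝ}

/-- The solution of `f' + m f = y`, `f 0 = a`, given by variation of constants. -/
noncomputable def linearODESol (m y : ℝ → ℝ) (a x : ℝ) : ℝ :=
  Real.exp (-∫ t in (0 : ℝ)..x, m t) *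
    (a + ∫ s in (0 : ℝ)..x, Real.exp (∫ t in (0 : ℝ)..s, m t) * y s)

/-- As m is only integrable, the product rule holds almost everywhere and is integrated through
absolute continuity. Since ∫m ≥ 0 and u ↦ e^{-u} is 1-Lipschitz on [0, ∞), both factors of the
formula are absolutely continuous. -/
theorem linearODESol_spec {l : ℝ} (hl : 0 ≤ l) (hm0 : ∀ x ∈ Ico 0 l, 0 ≤ m x)
    (hm : IntervalIntegrable m volume 0 l) (hy : IntervalIntegrable y volume 0 l) (a : ℝ) :
    ContinuousOn (linearODESol m y a) (Icc 0 l) ∧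
      linearODESol m y a l = a + ∫ x in (0 : ℝ)..l, (y x - m x * linearODESol m y a x) := by
  have hM := hm.absolutelyContinuousOnInterval_intervalIntegral (c := 0) left_mem_uIcc
  have hMc : ContinuousOn (fun x => ∫ t in (0 : ℝ)..x, m t) (uIcc 0 l) := hM.continuousOn
  have hMnn : ∀ x ∈ uIcc 0 l, 0 ≤ ∫ t in (0 : ℝ)..x, m t := by
    intro x hx
    rw [uIcc_of_le hl] at hx
    rw [intervalIntegral.integral_of_le hx.1, integral_Ioc_eq_integral_Ioo]
    exact setIntegral_nonneg measurableSet_Ioo fun t ht => hm0 t ⟨ht.1.le, ht.2.trans_le hx.2⟩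
  have hey : IntervalIntegrable (fun s => Real.exp (∫ t in (0 : ℝ)..s, m t) * y s) volume 0 l :=
    hy.continuousOn_mul hMc.rexp
  have hexp : LipschitzOnWith 1 (fun u : ℝ => Real.exp (-u)) (Ici 0) := by
    refine (convex_Ici 0).lipschitzOnWith_of_nnnorm_hasDerivWithin_le
      (f' := fun u => -Real.exp (-u)) (fun u _ => ?_) fun u hu => ?_
    · refine ((Real.hasDerivAt_exp (-u)).comp u (hasDerivAt_neg u)).hasDerivWithinAt.congr_deriv ?_
      rw [mul_neg_one]
    · rw [← NNReal.coe_le_coe, coe_nnnorm, norm_neg, Real.norm_of_nonneg (Real.exp_pos _).le]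
      simpa using hu
  have hE := hexp.comp_absolutelyContinuousOnInterval hM hMnn
  have hP := absolutelyContinuousOnInterval_const_add_integral (c := a) hey
  have hf : AbsolutelyContinuousOnInterval (linearODESol m y a) 0 l := hE.mul hP
  refine ⟨by simpa [uIcc_of_le hl] using hf.continuousOn, ?_⟩
  have h0 : linearODESol m y a 0 = a := by simp [linearODESol]
  have hint := hf.integral_deriv_eq_sub
  rw [h0] at hint
  rw [← sub_eq_iff_eq_add', ← hint]
  refine intervalIntegral.integral_congr_ae ?_
  filter_upwards [hm.ae_hasDerivAt_integral, hey.ae_hasDerivAt_integral] with x h1 h2 hx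
  have hx' := uIoc_subset_uIcc hx
  have d1 := ((Real.hasDerivAt_exp _).comp x (h1 hx' 0 left_mem_uIcc).neg)
  have d2 := (h2 hx' 0 left_mem_uIcc).const_add a
  refine (d1.mul d2).deriv.trans ?_
  simp only [linearODESol, Function.comp, Pi.neg_apply]
  have e : Real.exp (-∫ t in (0 : ℝ)..x, m t) * Real.exp (∫ t in (0 : ℝ)..x, m t) = 1 := by
    rw [← Real.exp_add, neg_add_cancel, Real.exp_zero]
  linear_combination y x * e

theorem linearODESol_nonneg {a x : ℝ} (hx : 0 ≤ x) (ha : 0 ≤ a)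
    (hy : ∀ᵐ t ∂volume.restrict (Ioo 0 x), 0 ≤ y t) : 0 ≤ linearODESol m y a x := by
  refine mul_nonneg (Real.exp_pos _).le (add_nonneg ha ?_)
  rw [intervalIntegral.integral_of_le hx, integral_Ioc_eq_integral_Ioo]
  refine integral_nonneg_of_ae ?_
  filter_upwards [hy] with t ht using mul_nonneg (Real.exp_pos _).le ht

/-- The coefficient may fail to be integrable at L. The L¹ estimate on [0, l] bounds ∫|mF| by |a| +
∫|y| independently of l < L, so mF is integrable on all of (0, L). -/
theorem exists_linearODE_solution (hL : 0 < L) (hm0 : ∀ x ∈ Ico 0 L, 0 ≤ m x)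
    (hm : ∀ l, 0 < l → l < L → IntegrableOn m (Ioo 0 l)) (hy : IntegrableOn y (Ioo 0 L)) (a : ℝ) :
    ∃ F : ℝ → ℝ, IntegrableOn (fun x => m x * F x) (Ioo 0 L) ∧
      (∀ x ∈ Icc 0 L, F x = a + ∫ t in (0 : ℝ)..x, (y t - m t * F t)) ∧
      (0 ≤ a → (∀ᵐ t ∂volume.restrict (Ioo 0 L), 0 ≤ y t) → ∀ x ∈ Ioo 0 L, 0 ≤ F x) := by
  set f := linearODESol m y a with hf
  have hyl : ∀ {l}, 0 ≤ l → l ≤ L → IntervalIntegrable y volume 0 l := fun h0 hl => by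
    rw [intervalIntegrable_iff_integrableOn_Ioo_of_le h0]
    exact hy.mono_set (Ioo_subset_Ioo_right hl)
  have hml : ∀ {l}, 0 ≤ l → l < L → IntervalIntegrable m volume 0 l := fun {l} h0 hl => by
    rcases h0.eq_or_lt with rfl | h0
    · exact IntervalIntegrable.refl
    rw [intervalIntegrable_iff_integrableOn_Ioo_of_le h0.le]
    exact hm _ h0 hl
  have hspec : ∀ l, 0 ≤ l → l < L → ContinuousOn f (Icc 0 l) ∧
      f l = a + ∫ x in (0 : ℝ)..l, (y x - m x * f x) := fun l h0 hl =>
    linearODESol_spec h0 (fun x hx => hm0 x ⟨hx.1, hx.2.trans hl⟩) (hml h0 hl) (hyl h0 hl.le) a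
  have hf0 : f 0 = a := by simp [hf, linearODESol]
  have hmf : ∀ {l}, 0 ≤ l → l < L → IntervalIntegrable (fun x => m x * f x) volume 0 l :=
    fun h0 hl => (hml h0 hl).mul_continuousOn (by rw [uIcc_of_le h0]; exact (hspec _ h0 hl).1)
  have hbound : ∀ l, 0 ≤ l → l < L →
      ∫ x in Ioo 0 l, ‖m x * f x‖ ≤ |a| + ∫ x in Ioo 0 L, |y x| := by
    intro l h0 hl
    have h := abs_add_integral_mul_abs_le h0 ((hyl h0 hl.le).sub (hmf h0 hl))
      (fun x hx => by rw [hf0]; exact (hspec x hx.1 (hx.2.trans_lt hl)).2)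
      (fun x hx => hm0 x ⟨hx.1, hx.2.trans hl⟩) (hmf h0 hl)
    simp only [sub_add_cancel, hf0] at h
    rw [intervalIntegral.integral_of_le h0, integral_Ioc_eq_integral_Ioo,
      intervalIntegral.integral_of_le h0, integral_Ioc_eq_integral_Ioo] at h
    have e : ∫ x in Ioo 0 l, ‖m x * f x‖ = ∫ x in Ioo 0 l, m x * |f x| :=
      setIntegral_congr_fun measurableSet_Ioo fun x hx => by
        simp only [Real.norm_eq_abs, abs_mul, abs_of_nonneg (hm0 x ⟨hx.1.le, hx.2.trans hl⟩)]
    have hle : ∫ x in Ioo 0 l, |y x| ≤ ∫ x in Ioo 0 L, |y x| :=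
      setIntegral_mono_set hy.abs (Eventually.of_forall fun x => abs_nonneg _)
        (Ioo_subset_Ioo_right hl.le).eventuallyLE
    rw [e]
    linarith [abs_nonneg (f l)]
  have hint : IntegrableOn (fun x => m x * f x) (Ioo 0 L) := by
    let u : ℕ → ℝ := fun n => L - L / (n + 1)
    have hu0 : ∀ n, 0 ≤ u n := fun n => by
      have : L / (n + 1) ≤ L := div_le_self hL.le (by linarith [n.cast_nonneg (α := ℝ)])
      exact sub_nonneg.2 this
    have huL : ∀ n, u n < L := fun n => sub_lt_self _ (by positivity)
    have hulim : Tendsto u atTop (𝓝 L) := by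
      have h := (tendsto_const_div_atTop_nhds_zero_nat L).comp (tendsto_add_atTop_nat 1)
      simpa [u, Function.comp_def] using h.const_sub L
    have hcov : AECover (volume.restrict (Ioo 0 L)) atTop fun n => Ioo 0 (u n) :=
      aecover_Ioo_of_Ioo tendsto_const_nhds hulim
    refine hcov.integrable_of_integral_norm_bounded (|a| + ∫ x in Ioo 0 L, |y x|) (fun n => ?_)
      (Eventually.of_forall fun n => ?_)
    · have h := hmf (hu0 n) (huL n)
      rw [intervalIntegrable_iff_integrableOn_Ioo_of_le (hu0 n)] at h
      exact h.mono_measure Measure.restrict_le_self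
    · rw [Measure.restrict_restrict measurableSet_Ioo, Ioo_inter_Ioo, max_self,
        min_eq_left (huL n).le]
      exact hbound _ (hu0 n) (huL n)
  -- At x = L the explicit formula may contain the default value of a divergent integral of m; the
  -- integral equation gives the correct endpoint value.
  let F : ℝ → ℝ := fun x => a + ∫ t in (0 : ℝ)..x, (y t - m t * f t)
  have hFf : ∀ x ∈ Ico 0 L, F x = f x := fun x hx => (hspec x hx.1 hx.2).2.symm
  refine ⟨F, hint.congr_fun (fun x hx => ?_) measurableSet_Ioo, fun x hx => ?_,
    fun ha hy0 x hx => ?_⟩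
  · simp only [hFf x ⟨hx.1.le, hx.2⟩]
  · change a + _ = a + _
    congr 1
    rw [intervalIntegral.integral_of_le hx.1, integral_Ioc_eq_integral_Ioo,
      intervalIntegral.integral_of_le hx.1, integral_Ioc_eq_integral_Ioo]
    refine setIntegral_congr_fun measurableSet_Ioo fun t ht => ?_
    simp only [hFf t ⟨ht.1.le, ht.2.trans_le hx.2⟩]
  · rw [hFf x ⟨hx.1.le, hx.2⟩]
    exact linearODESol_nonneg hx.1.le ha
      (ae_mono (Measure.restrict_mono (Ioo_subset_Ioo_right hx.2.le) le_rfl) hy0)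

end LinearODE

namespace RepairableSystem

variable {L : ℝ}

/-! ### Weak derivatives and primitives -/

theorem weakDeriv_apply {f g : L1 L} (h : IsWeakDeriv f g) (hf : f ∈ W11 L) :
    weakDeriv L ⟨f, hf⟩ = g :=
  IsWeakDeriv.unique (Exists.choose_spec hf) h

theorem isWeakDeriv_weakDeriv {f : L1 L} (hf : f ∈ W11 L) : IsWeakDeriv f (weakDeriv L ⟨f, hf⟩) :=
  Exists.choose_spec hf

theorem L1.intervalIntegrable (hL : 0 ≤ L) (g : L1 L) : IntervalIntegrable g volume 0 L := by
  rw [intervalIntegrable_iff_integrableOn_Ioo_of_le hL]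
  exact L1.integrable_coeFn g

theorem continuousOn_const_add_integral (hL : 0 ≤ L) {g : ℝ → ℝ}
    (hg : IntervalIntegrable g volume 0 L) (a : ℝ) :
    ContinuousOn (fun x => a + ∫ t in (0 : ℝ)..x, g t) (Icc 0 L) := by
  have := (absolutelyContinuousOnInterval_const_add_integral (c := a) hg).continuousOn
  rwa [uIcc_of_le hL] at this

theorem integral_Ioo_eq_intervalIntegral (hL : 0 ≤ L) (f : ℝ → ℝ) :
    ∫ x in Ioo 0 L, f x = ∫ x in (0 : ℝ)..L, f x := by
  rw [intervalIntegral.integral_of_le hL, integral_Ioc_eq_integral_Ioo]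

/-- Integration by parts of an absolutely continuous function against φ, which vanishes at both
endpoints. -/
theorem isWeakDeriv_of_ae_eq (hL : 0 ≤ L) {f g : L1 L} {a : ℝ}
    (h : f =ᵐ[volume.restrict (Ioo 0 L)] fun x => a + ∫ t in (0 : ℝ)..x, g t) :
    IsWeakDeriv f g := by
  intro φ hφ hs ht
  have hg := L1.intervalIntegrable hL g
  have hP := absolutelyContinuousOnInterval_const_add_integral (c := a) hg
  have hφac : AbsolutelyContinuousOnInterval φ 0 L :=
    (hφ.of_le (by simp)).contDiffOn.absolutelyContinuousOnInterval
  have hend : ∀ x, x ∉ Ioo 0 L → φ x = 0 := fun x hx =>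
    image_eq_zero_of_notMem_tsupport fun hx' => hx (ht hx')
  have e1 : ∫ x in Ioo 0 L, f x * deriv φ x =
      ∫ x in Ioo 0 L, (a + ∫ t in (0 : ℝ)..x, g t) * deriv φ x := by
    refine integral_congr_ae ?_
    filter_upwards [h] with x hx
    rw [hx]
  rw [e1, integral_Ioo_eq_intervalIntegral hL, integral_Ioo_eq_intervalIntegral hL,
    hP.integral_mul_deriv_eq_deriv_mul hφac, hend 0 (by simp), hend L (by simp), mul_zero,
    mul_zero, sub_zero, zero_sub, neg_inj]
  refine intervalIntegral.integral_congr_ae ?_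
  filter_upwards [hg.ae_hasDerivAt_integral] with x hx hx'
  rw [((hx (uIoc_subset_uIcc hx') 0 left_mem_uIcc).const_add a).deriv]

theorem hasValueAtZero_of_ae_eq (hL : 0 ≤ L) {f : L1 L} {g : ℝ → ℝ} {a : ℝ}
    (hg : IntervalIntegrable g volume 0 L)
    (h : f =ᵐ[volume.restrict (Ioo 0 L)] fun x => a + ∫ t in (0 : ℝ)..x, g t) :
    HasValueAtZero f a :=
  ⟨_, continuousOn_const_add_integral hL hg a, h, by simp⟩

/-- A test function with vanishing integral is the derivative of a test function. -/
theorem exists_deriv_eq_of_integral_eq_zero (hL : 0 < L) {θ : ℝ → ℝ} (hθ : ContDiff ℝ ∞ θ)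
    (hs : HasCompactSupport θ) (ht : tsupport θ ⊆ Ioo 0 L) (h0 : ∫ x, θ x = 0) :
    ∃ Φ : ℝ → ℝ, ContDiff ℝ ∞ Φ ∧ HasCompactSupport Φ ∧ tsupport Φ ⊆ Ioo 0 L ∧ deriv Φ = θ := by
  obtain ⟨α, β, hα, hβ, hK⟩ : ∃ α β, 0 < α ∧ β < L ∧ tsupport θ ⊆ Icc α β := by
    -- The extra point L/2 makes the set nonempty, so that it has a least and a greatest element
    -- even for θ = 0.
    have hc : IsCompact (insert (L / 2) (tsupport θ)) := IsCompact.insert hs _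
    have hsub : insert (L / 2) (tsupport θ) ⊆ Ioo 0 L :=
      insert_subset ⟨by linarith, by linarith⟩ ht
    obtain ⟨α, hα⟩ := hc.exists_isLeast (insert_nonempty _ _)
    obtain ⟨β, hβ⟩ := hc.exists_isGreatest (insert_nonempty _ _)
    exact ⟨α, β, (hsub hα.1).1, (hsub hβ.1).2, fun x hx =>
      ⟨hα.2 (mem_insert_of_mem _ hx), hβ.2 (mem_insert_of_mem _ hx)⟩⟩
  have hz : ∀ x, x ∉ Icc α β → θ x = 0 := fun x hx =>
    image_eq_zero_of_notMem_tsupport fun hx' => hx (hK hx')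
  let Φ : ℝ → ℝ := fun x => ∫ t in (0 : ℝ)..x, θ t
  have hd : ∀ x, HasDerivAt Φ (θ x) x := fun x => hθ.continuous.integral_hasStrictDerivAt 0 x
    |>.hasDerivAt
  have hderiv : deriv Φ = θ := funext fun x => (hd x).deriv
  have hsupp : Function.support Φ ⊆ Icc α β := by
    intro x hx
    by_contra hxn
    refine hx ?_
    rcases lt_or_ge x α with hxα | hxα
    · change ∫ t in (0 : ℝ)..x, θ t = 0
      refine intervalIntegral.integral_zero_ae (Eventually.of_forall fun t htx => hz t fun htK => ?_)
      have := htx.2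
      rw [le_max_iff] at this
      rcases this with h | h <;> linarith [htK.1]
    -- To the right of the support the primitive equals the total integral of θ, which is zero.
    · have hxβ : β < x := by
        by_contra! hc
        exact hxn ⟨hxα, hc⟩
      change ∫ t in (0 : ℝ)..x, θ t = 0
      rw [intervalIntegral.integral_of_le (hα.le.trans hxα),
        setIntegral_eq_integral_of_forall_compl_eq_zero fun t htx => hz t fun htK => ?_, h0]
      exact htx ⟨hα.trans_le htK.1, htK.2.trans hxβ.le⟩
  have hts : tsupport Φ ⊆ Icc α β := closure_minimal hsupp isClosed_Icc
  refine ⟨Φ, ?_, HasCompactSupport.of_support_subset_isCompact isCompact_Icc hsupp,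
    hts.trans fun x hx => ⟨hα.trans_le hx.1, hx.2.trans_lt hβ⟩, hderiv⟩
  rw [contDiff_infty_iff_deriv, hderiv]
  exact ⟨fun x => (hd x).differentiableAt, hθ⟩

theorem integral_Ioo_eq_integral {φ : ℝ → ℝ} (ht : tsupport φ ⊆ Ioo 0 L) (f : ℝ → ℝ) :
    ∫ x in Ioo 0 L, f x * φ x = ∫ x, f x * φ x := by
  refine setIntegral_eq_integral_of_forall_compl_eq_zero fun x hx => ?_
  rw [image_eq_zero_of_notMem_tsupport fun hx' => hx (ht hx'), mul_zero]

/-- A function whose weak derivative vanishes is constant. -/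
theorem IsWeakDeriv.exists_ae_eq_const (hL : 0 < L) {h : L1 L} (hh : IsWeakDeriv h 0) :
    ∃ c : ℝ, ∀ᵐ x ∂volume.restrict (Ioo 0 L), h x = c := by
  let b : ContDiffBump (L / 2) := ⟨L / 8, L / 4, by positivity, by linarith⟩
  let φ₀ := b.normed volume
  have hφ₀ : ContDiff ℝ ∞ φ₀ := b.contDiff_normed
  have hs₀ : HasCompactSupport φ₀ := b.hasCompactSupport_normed
  have ht₀ : tsupport φ₀ ⊆ Ioo 0 L := by
    rw [b.tsupport_normed_eq, Real.closedBall_eq_Icc]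
    exact fun x hx => ⟨by linarith [hx.1, show b.rOut = L / 4 from rfl],
      by linarith [hx.2, show b.rOut = L / 4 from rfl]⟩
  have hi₀ : ∫ x, φ₀ x = 1 := b.integral_normed
  have hzero : ∀ φ : ℝ → ℝ, ContDiff ℝ ∞ φ → HasCompactSupport φ → tsupport φ ⊆ Ioo 0 L →
      ∫ x in Ioo 0 L, h x * deriv φ x = 0 := by
    intro φ hφ hs ht
    rw [hh φ hφ hs ht, neg_eq_zero]
    have := integral_smul_mul 0 (0 : L1 L) φ
    rwa [zero_smul, zero_mul] at this
  set c := ∫ x in Ioo 0 L, h x * φ₀ x with hc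
  refine ⟨c, ?_⟩
  have key : ∀ᵐ x ∂volume, x ∈ Ioo 0 L → h x - c = 0 := by
    refine isOpen_Ioo.ae_eq_zero_of_integral_contDiff_smul_eq_zero ?_ fun ψ hψ hs ht => ?_
    · have hi : IntegrableOn (fun x => h x - c) (Ioo 0 L) volume :=
        (L1.integrable_coeFn h).sub (integrable_const c)
      exact hi.locallyIntegrableOn
    -- Since φ₀ has integral 1, ψ - κφ₀ has integral 0 and is the derivative of a test function.
    -- Hence ∫hψ = κ∫hφ₀ = c∫ψ.
    set κ := ∫ x, ψ x with hκ
    have hθs : HasCompactSupport (fun x => ψ x - κ * φ₀ x) := hs.sub hs₀.mul_left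
    have hθt : tsupport (fun x => ψ x - κ * φ₀ x) ⊆ Ioo 0 L :=
      (tsupport_sub ψ fun x => κ * φ₀ x).trans
        (union_subset ht ((tsupport_mul_subset_right (f := fun _ => κ)).trans ht₀))
    have hψi : Integrable ψ := hψ.continuous.integrable_of_hasCompactSupport hs
    have hφi : Integrable φ₀ := hφ₀.continuous.integrable_of_hasCompactSupport hs₀
    obtain ⟨Φ, hΦ, hΦs, hΦt, hΦd⟩ := exists_deriv_eq_of_integral_eq_zero hL
      (hψ.sub (contDiff_const.mul hφ₀)) hθs hθt (by
        rw [integral_sub hψi (hφi.const_mul κ), integral_const_mul, hi₀, mul_one, sub_self])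
    have h1 := hzero Φ hΦ hΦs hΦt
    have hhψ := integrable_mul_of_continuous h hψ.continuous hs
    have hhφ := integrable_mul_of_continuous h hφ₀.continuous hs₀
    have e : ∫ x in Ioo 0 L, h x * deriv Φ x = (∫ x in Ioo 0 L, h x * ψ x) - κ * c := by
      rw [hc, ← integral_const_mul, ← integral_sub hhψ (hhφ.const_mul κ), hΦd]
      congr 1
      ext x
      ring
    rw [e] at h1
    have hψ1 : ∫ x in Ioo 0 L, ψ x = κ := by
      have := integral_Ioo_eq_integral ht fun _ => 1
      simpa using this
    calc ∫ x, ψ x • (h x - c) = ∫ x in Ioo 0 L, (h x - c) * ψ x := by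
          rw [integral_Ioo_eq_integral ht fun x => h x - c]
          simp only [smul_eq_mul, mul_comm]
      _ = (∫ x in Ioo 0 L, h x * ψ x) - c * ∫ x in Ioo 0 L, ψ x := by
          rw [← integral_const_mul, ← integral_sub hhψ (hψi.integrableOn.const_mul c)]
          simp only [sub_mul]
      _ = 0 := by rw [hψ1, mul_comm, h1]
  filter_upwards [(ae_restrict_iff' measurableSet_Ioo).2 key] with x hx
  exact sub_eq_zero.1 hx

theorem eq_of_ae_eq_of_continuousOn (hL : 0 < L) {F G : ℝ → ℝ} (hF : ContinuousOn F (Icc 0 L))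
    (hG : ContinuousOn G (Icc 0 L)) (h : F =ᵐ[volume.restrict (Ioo 0 L)] G) : F 0 = G 0 := by
  have h1 : EqOn F G (Ioo 0 L) := Measure.eqOn_open_of_ae_eq h isOpen_Ioo
    (hF.mono Ioo_subset_Icc_self) (hG.mono Ioo_subset_Icc_self)
  have h2 := h1.of_subset_closure hF hG Ioo_subset_Icc_self (by rw [closure_Ioo hL.ne])
  exact h2 ⟨le_rfl, hL.le⟩

/-- The difference of f and the primitive of g has weak derivative zero, hence is constant;
comparing continuous representatives at 0 identifies the constant as a. -/
theorem IsWeakDeriv.ae_eq (hL : 0 < L) {f g : L1 L} {a : ℝ} (h : IsWeakDeriv f g)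
    (ha : HasValueAtZero f a) :
    f =ᵐ[volume.restrict (Ioo 0 L)] fun x => a + ∫ t in (0 : ℝ)..x, g t := by
  have hg := L1.intervalIntegrable hL.le g
  have hi : Integrable (fun x => 0 + ∫ t in (0 : ℝ)..x, g t) (volume.restrict (Ioo 0 L)) :=
    ((continuousOn_const_add_integral hL.le hg 0).integrableOn_Icc).mono_set Ioo_subset_Icc_self
  have hG : IsWeakDeriv (hi.toL1 _) g := isWeakDeriv_of_ae_eq hL.le hi.coeFn_toL1
  have hdiff : IsWeakDeriv (f + (-1 : ℝ) • hi.toL1 _) 0 := by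
    have := h.add (hG.smul (-1))
    rwa [neg_one_smul ℝ g, add_neg_cancel] at this
  obtain ⟨c, hc⟩ := hdiff.exists_ae_eq_const hL
  have hfc : f =ᵐ[volume.restrict (Ioo 0 L)] fun x => c + ∫ t in (0 : ℝ)..x, g t := by
    filter_upwards [hc, Lp.coeFn_add f ((-1 : ℝ) • hi.toL1 _), Lp.coeFn_smul (-1 : ℝ) (hi.toL1 _),
      hi.coeFn_toL1] with x h1 h2 h3 h4
    rw [h2, Pi.add_apply, h3, Pi.smul_apply, h4] at h1
    rw [← h1, smul_eq_mul]
    ring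
  obtain ⟨F, hF, hfF, rfl⟩ := ha
  have := eq_of_ae_eq_of_continuousOn hL hF (continuousOn_const_add_integral hL.le hg c)
    (hfF.symm.trans hfc)
  rw [intervalIntegral.integral_same, add_zero] at this
  rwa [this]

/-! ### The stationary equation for one component -/

/-- `p ∈ W^{1,1}(0, L)` solves `p' + μ p + c p = y` with `p(0) = a`. -/
structure IsSolution (μ : ℝ → ℝ) (c : ℝ) (y p : L1 L) (a : ℝ) : Prop where
  mem_W11 : p ∈ W11 L
  mem_mulDomain : p ∈ mulDomain L μ
  eq : weakDeriv L ⟨p, mem_W11⟩ + mulOp L μ ⟨p, mem_mulDomain⟩ + c • p = y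
  hasValueAtZero : HasValueAtZero p a

theorem mulOp_ae_eq {μ : ℝ → ℝ} {p : L1 L} (hp : p ∈ mulDomain L μ) :
    mulOp L μ ⟨p, hp⟩ =ᵐ[volume.restrict (Ioo 0 L)] fun x => μ x * p x :=
  (mem_mulDomain.1 hp).coeFn_toL1

theorem IsSolution.add {μ : ℝ → ℝ} {c a a' : ℝ} {y y' p p' : L1 L} (h : IsSolution μ c y p a)
    (h' : IsSolution μ c y' p' a') : IsSolution μ c (y + y') (p + p') (a + a') := by
  obtain ⟨hw, hm, rfl, hv⟩ := h
  obtain ⟨hw', hm', rfl, hv'⟩ := h'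
  refine ⟨add_mem hw hw', add_mem hm hm', ?_, hv.add hv'⟩
  have e1 := (weakDeriv L).map_add ⟨p, hw⟩ ⟨p', hw'⟩
  have e2 := (mulOp L μ).map_add ⟨p, hm⟩ ⟨p', hm'⟩
  refine (congrArg₂ (fun u v => u + v + c • (p + p')) e1 e2).trans ?_
  rw [smul_add]
  abel

theorem IsSolution.smul {μ : ℝ → ℝ} {c a : ℝ} {y p : L1 L} (s : ℝ) (h : IsSolution μ c y p a) :
    IsSolution μ c (s • y) (s • p) (s * a) := by
  obtain ⟨hw, hm, rfl, hv⟩ := h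
  refine ⟨Submodule.smul_mem _ s hw, Submodule.smul_mem _ s hm, ?_, hv.smul s⟩
  have e1 := (weakDeriv L).map_smul s ⟨p, hw⟩
  have e2 := (mulOp L μ).map_smul s ⟨p, hm⟩
  refine (congrArg₂ (fun u v => u + v + c • (s • p)) e1 e2).trans ?_
  rw [smul_add, smul_add, smul_comm c s]

variable {N : ℕ} {μ : ℝ → ℝ}

/-- The balance law for one component: the estimate for F' + mF with m = μ + c on all of [0, L],
where the outgoing term |F(L)| is dropped. -/
theorem IsSolution.integral_mul_abs_add_le (hL : 0 < L) (hμ : IsRepairRate L N μ) {c a : ℝ}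
    (hc : 0 ≤ c) {y p : L1 L} (h : IsSolution μ c y p a) :
    (∫ x in Ioo 0 L, μ x * |p x|) + c * ‖p‖ ≤ |a| + ‖y‖ := by
  set q := weakDeriv L ⟨p, h.mem_W11⟩ with hq
  set F : ℝ → ℝ := fun x => a + ∫ t in (0 : ℝ)..x, q t with hF
  have hpF : p =ᵐ[volume.restrict (Ioo 0 L)] F :=
    (isWeakDeriv_weakDeriv h.mem_W11).ae_eq hL h.hasValueAtZero
  have hF0 : F 0 = a := by simp [hF]
  have hμp : Integrable (fun x => μ x * p x) (volume.restrict (Ioo 0 L)) := h.mem_mulDomain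
  have hmp : Integrable (fun x => (μ x + c) * p x) (volume.restrict (Ioo 0 L)) := by
    simp only [add_mul]
    exact hμp.add ((L1.integrable_coeFn p).const_mul c)
  have hmF : IntervalIntegrable (fun x => (μ x + c) * F x) volume 0 L := by
    rw [intervalIntegrable_iff_integrableOn_Ioo_of_le hL.le]
    refine hmp.congr ?_
    filter_upwards [hpF] with x hx
    rw [hx]
  have hest := abs_add_integral_mul_abs_le hL.le (L1.intervalIntegrable hL.le q)
    (fun x _ => by rw [hF0]) (fun x hx => add_nonneg (hμ.nonneg x hx) hc) hmF
  rw [hF0, ← integral_Ioo_eq_intervalIntegral hL.le, ← integral_Ioo_eq_intervalIntegral hL.le]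
    at hest
  have e1 : ∫ x in Ioo 0 L, (μ x + c) * |F x| = (∫ x in Ioo 0 L, μ x * |p x|) + c * ‖p‖ := by
    rw [L1.norm_eq_integral_norm, ← integral_const_mul, ← integral_add]
    · refine integral_congr_ae ?_
      filter_upwards [hpF] with x hx
      rw [hx, add_mul, Real.norm_eq_abs]
    · refine hμp.abs.congr ?_
      filter_upwards [ae_restrict_mem measurableSet_Ioo] with x hx
      rw [abs_mul, abs_of_nonneg (hμ.nonneg x ⟨hx.1.le, hx.2⟩)]
    · exact (L1.integrable_coeFn p).norm.const_mul c
  have e2 : ∫ x in Ioo 0 L, |q x + (μ x + c) * F x| = ‖y‖ := by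
    rw [L1.norm_eq_integral_norm, ← h.eq]
    refine integral_congr_ae ?_
    filter_upwards [hpF, mulOp_ae_eq h.mem_mulDomain, Lp.coeFn_smul c p,
      Lp.coeFn_add q (mulOp L μ ⟨p, h.mem_mulDomain⟩),
      Lp.coeFn_add (q + mulOp L μ ⟨p, h.mem_mulDomain⟩) (c • p)] with x h1 h2 h3 h4 h5
    rw [h5, Pi.add_apply, h4, Pi.add_apply, h3, Pi.smul_apply, h2, ← h1, Real.norm_eq_abs,
      smul_eq_mul]
    congr 1
    ring
  rw [e1, e2] at hest
  linarith [abs_nonneg (F L)]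

theorem exists_isSolution (hL : 0 < L) (hμ : IsRepairRate L N μ) {c : ℝ} (hc : 0 ≤ c) (y : L1 L)
    (a : ℝ) : ∃ p : L1 L, IsSolution μ c y p a ∧ (0 ≤ a → 0 ≤ y → 0 ≤ p) := by
  obtain ⟨F, hmF, hF, hpos⟩ := exists_linearODE_solution (m := fun x => μ x + c) hL
    (fun x hx => add_nonneg (hμ.nonneg x hx) hc)
    (fun l h0 hl => (hμ.integrableOn l h0 hl).add (integrableOn_const (by simp)))
    (L1.integrable_coeFn y) a
  have hq : Integrable (fun x => y x - (μ x + c) * F x) (volume.restrict (Ioo 0 L)) :=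
    (L1.integrable_coeFn y).sub hmF
  have hqi : IntervalIntegrable (fun x => y x - (μ x + c) * F x) volume 0 L := by
    rwa [intervalIntegrable_iff_integrableOn_Ioo_of_le hL.le]
  have hFc : ContinuousOn F (Icc 0 L) := (continuousOn_const_add_integral hL.le hqi a).congr hF
  have hFi : Integrable F (volume.restrict (Ioo 0 L)) :=
    hFc.integrableOn_Icc.mono_set Ioo_subset_Icc_self
  have hpF := hFi.coeFn_toL1
  have hpq : hFi.toL1 F =ᵐ[volume.restrict (Ioo 0 L)]
      fun x => a + ∫ t in (0 : ℝ)..x, hq.toL1 _ t := by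
    filter_upwards [hpF, ae_restrict_mem measurableSet_Ioo] with x h1 hx
    rw [h1, hF x (Ioo_subset_Icc_self hx), intervalIntegral.integral_of_le hx.1.le,
      integral_Ioc_eq_integral_Ioo, intervalIntegral.integral_of_le hx.1.le,
      integral_Ioc_eq_integral_Ioo]
    congr 1
    exact integral_congr_ae (ae_mono
      (Measure.restrict_mono (Ioo_subset_Ioo_right hx.2.le) le_rfl) hq.coeFn_toL1.symm)
  have hwd := isWeakDeriv_of_ae_eq hL.le hpq
  have hmul : hFi.toL1 F ∈ mulDomain L μ := by
    refine (Integrable.sub hmF (hFi.const_mul c)).congr ?_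
    filter_upwards [hpF] with x hx
    rw [hx, Pi.sub_apply]
    ring
  have hW : hFi.toL1 F ∈ W11 L := ⟨_, hwd⟩
  refine ⟨hFi.toL1 F, ⟨hW, hmul, ?_,
    hasValueAtZero_of_ae_eq hL.le (L1.intervalIntegrable hL.le _) hpq⟩, fun ha hy => ?_⟩
  · rw [weakDeriv_apply hwd hW]
    refine Lp.ext ?_
    filter_upwards [hpF, mulOp_ae_eq hmul, Lp.coeFn_smul c (hFi.toL1 F), hq.coeFn_toL1,
      Lp.coeFn_add (hq.toL1 _) (mulOp L μ ⟨_, hmul⟩),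
      Lp.coeFn_add (hq.toL1 _ + mulOp L μ ⟨_, hmul⟩) (c • hFi.toL1 F)] with x h1 h2 h3 h4 h5 h6
    rw [h6, Pi.add_apply, h5, Pi.add_apply, h4, h3, Pi.smul_apply, h2, h1, smul_eq_mul]
    ring
  · rw [← Lp.coeFn_nonneg] at hy ⊢
    filter_upwards [hpF, ae_restrict_mem measurableSet_Ioo] with x hx hx'
    rw [hx]
    exact hpos ha hy x hx'

/-! ### Density -/

/-- The product μF is integrable because F vanishes beyond l, and μ is integrable on (0, l). -/
theorem toL1_mem_of_contDiff (hL : 0 < L) (hμ : IsRepairRate L N μ) {F : ℝ → ℝ}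
    (hF : ContDiff ℝ ∞ F) (hF0 : F 0 = 0) {l : ℝ} (hl0 : 0 < l) (hl : l < L)
    (hFl : ∀ x, l ≤ x → F x = 0) (hi : Integrable F (volume.restrict (Ioo 0 L))) :
    hi.toL1 F ∈ W11 L ∧ hi.toL1 F ∈ mulDomain L μ ∧ HasValueAtZero (hi.toL1 F) 0 := by
  have hac : ∀ x, AbsolutelyContinuousOnInterval F 0 x := fun x =>
    (hF.of_le (by simp)).contDiffOn.absolutelyContinuousOnInterval
  have hd : IntegrableOn (deriv F) (Ioo 0 L) :=
    ((hF.continuous_deriv (by simp)).continuousOn.integrableOn_Icc).mono_set Ioo_subset_Icc_self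
  have hpq : hi.toL1 F =ᵐ[volume.restrict (Ioo 0 L)]
      fun x => 0 + ∫ t in (0 : ℝ)..x, Integrable.toL1 _ hd t := by
    filter_upwards [hi.coeFn_toL1, ae_restrict_mem measurableSet_Ioo] with x h1 hx
    have h2 := (hac x).integral_deriv_eq_sub
    rw [hF0, sub_zero] at h2
    rw [h1, zero_add, ← h2, intervalIntegral.integral_of_le hx.1.le,
      integral_Ioc_eq_integral_Ioo, intervalIntegral.integral_of_le hx.1.le,
      integral_Ioc_eq_integral_Ioo]
    exact integral_congr_ae (ae_mono
      (Measure.restrict_mono (Ioo_subset_Ioo_right hx.2.le) le_rfl)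
      (Integrable.coeFn_toL1 hd).symm)
  refine ⟨⟨_, isWeakDeriv_of_ae_eq hL.le hpq⟩, ?_,
    hasValueAtZero_of_ae_eq hL.le (L1.intervalIntegrable hL.le _) hpq⟩
  obtain ⟨C, hC⟩ := isCompact_Icc.exists_bound_of_continuousOn
    (s := Icc 0 l) hF.continuous.continuousOn
  have h1 : IntegrableOn (fun x => μ x * F x) (Ioo 0 l) := by
    refine (hμ.integrableOn l hl0 hl).mul_bdd (c := C) hF.continuous.aestronglyMeasurable ?_
    filter_upwards [ae_restrict_mem measurableSet_Ioo] with x hx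
    exact hC x (Ioo_subset_Icc_self hx)
  have h2 : IntegrableOn (fun x => μ x * F x) (Ioo 0 L) := by
    refine h1.of_forall_sdiff_eq_zero measurableSet_Ioo fun x hx => ?_
    rw [hFl x (not_lt.1 fun h => hx.2 ⟨hx.1.1, h⟩), mul_zero]
  refine Integrable.congr h2 ?_
  filter_upwards [hi.coeFn_toL1] with x hx
  rw [hx]

theorem exists_norm_sub_lt_of_contDiff (hL : 0 < L) (hμ : IsRepairRate L N μ) {g : ℝ → ℝ}
    (hg : ContDiff ℝ ∞ g) (hi : Integrable g (volume.restrict (Ioo 0 L))) {ε : ℝ} (hε : 0 < ε) :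
    ∃ p ∈ W11 L, p ∈ mulDomain L μ ∧ HasValueAtZero p 0 ∧ ‖hi.toL1 g - p‖ < ε := by
  -- The cutoffs equal 1 on [2δ, L - 2δ] and vanish outside (δ, L - δ). The cap δ ≤ L/8 keeps the
  -- inner radius L/2 - 2δ positive.
  let δ : ℕ → ℝ := fun n => L / 8 / ((n : ℝ) + 1)
  have hδ0 : ∀ n, 0 < δ n := fun n => by positivity
  have hδL : ∀ n, δ n ≤ L / 8 := fun n =>
    div_le_self (by positivity) (by linarith [n.cast_nonneg (α := ℝ)])
  have hδlim : Tendsto δ atTop (𝓝 0) := by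
    have h := (tendsto_const_div_atTop_nhds_zero_nat (L / 8)).comp (tendsto_add_atTop_nat 1)
    simpa [δ, Function.comp_def] using h
  let b : ℕ → ContDiffBump (L / 2) := fun n =>
    ⟨L / 2 - 2 * δ n, L / 2 - δ n, by linarith [hδL n], by linarith [hδ0 n]⟩
  have hle : ∀ n x, ‖g x - b n x * g x‖ ≤ ‖g x‖ := fun n x => by
    rw [← one_sub_mul, norm_mul, Real.norm_of_nonneg (sub_nonneg.2 (b n).le_one)]
    exact mul_le_of_le_one_left (norm_nonneg _) (by linarith [(b n).nonneg (x := x)])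
  have hbi : ∀ n, Integrable (fun x => b n x * g x) (volume.restrict (Ioo 0 L)) := fun n =>
    (((b n).continuous.mul hg.continuous).continuousOn.integrableOn_Icc).mono_set
      Ioo_subset_Icc_self
  have hlim : Tendsto (fun n => ∫ x in Ioo 0 L, ‖g x - b n x * g x‖) atTop (𝓝 0) := by
    suffices h : Tendsto (fun n => ∫ x in Ioo 0 L, ‖g x - b n x * g x‖) atTop
        (𝓝 (∫ _ in Ioo 0 L, (0 : ℝ))) by rwa [integral_zero] at h
    refine tendsto_integral_of_dominated_convergence (fun x => ‖g x‖)
      (fun n => (hi.sub (hbi n)).norm.aestronglyMeasurable) hi.norm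
      (fun n => Eventually.of_forall fun x => ?_) ?_
    · rw [norm_norm]
      exact hle n x
    · filter_upwards [ae_restrict_mem measurableSet_Ioo] with x hx
      have hx' : 0 < (L / 2 - |x - L / 2|) / 2 := by
        have : |x - L / 2| < L / 2 := abs_lt.2 ⟨by linarith [hx.1], by linarith [hx.2]⟩
        linarith
      refine tendsto_const_nhds.congr' ?_
      filter_upwards [hδlim.eventually_lt_const hx'] with n hn
      have : x ∈ Metric.closedBall (L / 2) (b n).rIn := by
        rw [Metric.mem_closedBall, Real.dist_eq]
        change |x - L / 2| ≤ L / 2 - 2 * δ n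
        linarith
      rw [(b n).one_of_mem_closedBall this, one_mul, sub_self, norm_zero]
  obtain ⟨n, hn⟩ := (hlim.eventually_lt_const hε).exists
  have hz : ∀ x, L / 2 - δ n ≤ |x - L / 2| → b n x * g x = 0 := fun x hx => by
    rw [(b n).zero_of_le_dist (by rwa [Real.dist_eq]), zero_mul]
  obtain ⟨h1, h2, h3⟩ := toL1_mem_of_contDiff hL hμ ((b n).contDiff.mul hg)
    (hz 0 (by rw [zero_sub, abs_neg, abs_of_pos (by positivity)]; linarith [hδ0 n]))
    (l := L - δ n) (by linarith [hδL n]) (by linarith [hδ0 n])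
    (fun x hx => hz x (by linarith [le_abs_self (x - L / 2)])) (hbi n)
  refine ⟨_, h1, h2, h3, ?_⟩
  rw [← Integrable.toL1_sub, L1.norm_of_fun_eq_integral_norm]
  exact hn

/-- The boundary value is carried by a solution φ of φ' + μφ = 0 with φ(0) = a; the remainder f - φ
is approximated by functions vanishing at 0. -/
theorem exists_norm_sub_lt (hL : 0 < L) (hμ : IsRepairRate L N μ) (f : L1 L) (a : ℝ) {ε : ℝ}
    (hε : 0 < ε) :
    ∃ p ∈ W11 L, p ∈ mulDomain L μ ∧ HasValueAtZero p a ∧ ‖f - p‖ < ε := by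
  obtain ⟨φ, hφ, -⟩ := exists_isSolution hL hμ le_rfl 0 a
  obtain ⟨u, ⟨g, hug, hgs, hg⟩, hu⟩ := Metric.mem_closure_iff.1
    (Lp.dense_hasCompactSupport_contDiff (p := 1) (by simp) (f - φ)) (ε / 2) (by positivity)
  have hi : Integrable g (volume.restrict (Ioo 0 L)) := (L1.integrable_coeFn u).congr hug
  have hgu : hi.toL1 g = u := Lp.ext (hi.coeFn_toL1.trans hug.symm)
  obtain ⟨p, h1, h2, h3, h4⟩ := exists_norm_sub_lt_of_contDiff hL hμ hg hi (half_pos hε)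
  rw [hgu] at h4
  rw [dist_eq_norm] at hu
  refine ⟨φ + p, add_mem hφ.mem_W11 h1, add_mem hφ.mem_mulDomain h2,
    (hφ.hasValueAtZero.add h3).of_eq (add_zero a), ?_⟩
  have e : f - (φ + p) = (f - φ - u) + (u - p) := by abel
  rw [e]
  linarith [norm_add_le (f - φ - u) (u - p)]

theorem StateSpace.norm_eq (p : StateSpace L) :
    ‖p‖ = |p.fst| + (‖p.snd.fst‖ + ‖p.snd.snd‖) := by
  rw [WithLp.prod_norm_eq_of_L1, WithLp.prod_norm_eq_of_L1, Real.norm_eq_abs]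

variable {lam₁ lam₂ : ℝ} {μ₁ μ₂ : ℝ → ℝ}

theorem dense_systemDomain (hL : 0 < L) (hμ₁ : IsRepairRate L N μ₁) (hμ₂ : IsRepairRate L N μ₂) :
    Dense (systemDomain L lam₁ lam₂ μ₁ μ₂ : Set (StateSpace L)) := by
  intro p
  rw [Metric.mem_closure_iff]
  intro ε hε
  obtain ⟨q₁, h1, h2, h3, h4⟩ :=
    exists_norm_sub_lt hL hμ₁ p.snd.fst (lam₁ * p.fst) (half_pos hε)
  -- The boundary value of the second function involves ∫q₁, so q₁ has to be fixed first.
  obtain ⟨q₂, k1, k2, k3, k4⟩ := exists_norm_sub_lt hL hμ₂ p.snd.snd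
    (lam₂ * p.fst + lam₂ * ∫ x in Ioo 0 L, q₁ x) (half_pos hε)
  refine ⟨StateSpace.mk p.fst q₁ q₂, ⟨⟨h1, k1⟩, ⟨h2, k2⟩, h3, k3⟩, ?_⟩
  rw [dist_eq_norm, StateSpace.norm_eq]
  change |p.fst - p.fst| + (‖p.snd.fst - q₁‖ + ‖p.snd.snd - q₂‖) < ε
  rw [sub_self, abs_zero]
  linarith

/-! ### The resolvent equation -/

theorem resolvent_eq_iff {γ : ℝ} {y x : StateSpace L} :
    (∃ h : x ∈ (systemOperator L lam₁ lam₂ μ₁ μ₂).domain,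
      γ • x - systemOperator L lam₁ lam₂ μ₁ μ₂ ⟨x, h⟩ = y) ↔
    IsSolution μ₁ (γ + lam₂) y.snd.fst x.snd.fst (lam₁ * x.fst) ∧
    IsSolution μ₂ γ y.snd.snd x.snd.snd
      (lam₂ * x.fst + lam₂ * ∫ t in Ioo 0 L, x.snd.fst t) ∧
    (γ + lam₁ + lam₂) * x.fst - (∫ t in Ioo 0 L, μ₁ t * x.snd.fst t)
      - (∫ t in Ioo 0 L, μ₂ t * x.snd.snd t) = y.fst := by
  constructor
  · rintro ⟨⟨⟨h1, k1⟩, ⟨h2, k2⟩, h3, k3⟩, rfl⟩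
    refine ⟨⟨h1, h2, ?_, h3⟩, ⟨k1, k2, ?_, k3⟩, ?_⟩
    · change _ = γ • x.snd.fst - -(weakDeriv L ⟨x.snd.fst, h1⟩ + mulOp L μ₁ ⟨x.snd.fst, h2⟩
            + lam₂ • x.snd.fst)
      rw [add_smul]
      abel
    · change _ = γ • x.snd.snd - -(weakDeriv L ⟨x.snd.snd, k1⟩ + mulOp L μ₂ ⟨x.snd.snd, k2⟩)
      abel
    · change _ = γ * x.fst - (-(lam₁ + lam₂) * x.fst + (∫ t in Ioo 0 L, μ₁ t * x.snd.fst t)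
            + ∫ t in Ioo 0 L, μ₂ t * x.snd.snd t)
      ring
  · rintro ⟨⟨h1, h2, e1, h3⟩, ⟨k1, k2, e2, k3⟩, e0⟩
    refine ⟨⟨⟨h1, k1⟩, ⟨h2, k2⟩, h3, k3⟩, ?_⟩
    refine WithLp.ofLp_injective _ (Prod.ext ?_ (WithLp.ofLp_injective _ (Prod.ext ?_ ?_)))
    · change γ * x.fst - (-(lam₁ + lam₂) * x.fst + (∫ t in Ioo 0 L, μ₁ t * x.snd.fst t)
            + ∫ t in Ioo 0 L, μ₂ t * x.snd.snd t) = y.fst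
      rw [← e0]
      ring
    · change γ • x.snd.fst - -(weakDeriv L ⟨x.snd.fst, h1⟩ + mulOp L μ₁ ⟨x.snd.fst, h2⟩
            + lam₂ • x.snd.fst) = y.snd.fst
      rw [← e1, add_smul]
      abel
    · change γ • x.snd.snd - -(weakDeriv L ⟨x.snd.snd, k1⟩ + mulOp L μ₂ ⟨x.snd.snd, k2⟩) =
        y.snd.snd
      rw [← e2]
      abel

theorem abs_integral_mul_le (hμ : IsRepairRate L N μ) (p : L1 L) :
    |∫ x in Ioo 0 L, μ x * p x| ≤ ∫ x in Ioo 0 L, μ x * |p x| := by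
  refine abs_integral_le_integral_abs.trans_eq
    (setIntegral_congr_fun measurableSet_Ioo fun x hx => ?_)
  simp only [abs_mul, abs_of_nonneg (hμ.nonneg x ⟨hx.1.le, hx.2⟩)]

theorem abs_integral_le_norm (p : L1 L) : |∫ x in Ioo 0 L, p x| ≤ ‖p‖ := by
  rw [L1.norm_eq_integral_norm]
  exact abs_integral_le_integral_abs

/-- The three balances are added: ∫μᵢ|pᵢ| gained by p₀ is lost by pᵢ, the rates lam₁|p₀| and
lam₂|p₀| lost by p₀ enter p₁ and p₂, and lam₂‖p₁‖ passes from p₁ to p₂. -/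
theorem systemOperator_dissipative (hL : 0 < L) (hlam₁ : 0 < lam₁) (hlam₂ : 0 < lam₂)
    (hμ₁ : IsRepairRate L N μ₁) (hμ₂ : IsRepairRate L N μ₂) {γ : ℝ} (hγ : 0 < γ)
    (x : (systemOperator L lam₁ lam₂ μ₁ μ₂).domain) :
    γ * ‖(x : StateSpace L)‖ ≤
      ‖γ • (x : StateSpace L) - systemOperator L lam₁ lam₂ μ₁ μ₂ x‖ := by
  obtain ⟨x, hx⟩ := x
  set y := γ • x - systemOperator L lam₁ lam₂ μ₁ μ₂ ⟨x, hx⟩ with hy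
  obtain ⟨h1, h2, h0⟩ := resolvent_eq_iff.1 ⟨hx, hy.symm⟩
  have e1 := h1.integral_mul_abs_add_le hL hμ₁ (by positivity)
  have e2 := h2.integral_mul_abs_add_le hL hμ₂ hγ.le
  have b1 := abs_integral_mul_le hμ₁ x.snd.fst
  have b2 := abs_integral_mul_le hμ₂ x.snd.snd
  have b3 := abs_integral_le_norm x.snd.fst
  have e0 : (γ + lam₁ + lam₂) * |x.fst| ≤ |y.fst| +
      |∫ t in Ioo 0 L, μ₁ t * x.snd.fst t| + |∫ t in Ioo 0 L, μ₂ t * x.snd.snd t| := by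
    rw [← abs_of_pos (show 0 < γ + lam₁ + lam₂ by positivity), ← abs_mul,
      show (γ + lam₁ + lam₂) * x.fst = y.fst + (∫ t in Ioo 0 L, μ₁ t * x.snd.fst t) +
        (∫ t in Ioo 0 L, μ₂ t * x.snd.snd t) by linarith]
    exact abs_add_three _ _ _
  have c1 : |lam₁ * x.fst| = lam₁ * |x.fst| := by rw [abs_mul, abs_of_pos hlam₁]
  have c2 : |lam₂ * x.fst + lam₂ * ∫ t in Ioo 0 L, x.snd.fst t| ≤
      lam₂ * |x.fst| + lam₂ * ‖x.snd.fst‖ := by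
    rw [← mul_add, abs_mul, abs_of_pos hlam₂, ← mul_add]
    exact mul_le_mul_of_nonneg_left ((abs_add_le _ _).trans (by gcongr)) hlam₂.le
  rw [StateSpace.norm_eq, StateSpace.norm_eq]
  rw [c1] at e1
  change γ * (|x.fst| + (‖x.snd.fst‖ + ‖x.snd.snd‖)) ≤ _
  linarith

theorem integral_nonneg_of_nonneg {p : L1 L} (hp : 0 ≤ p) : 0 ≤ ∫ x in Ioo 0 L, p x :=
  integral_nonneg_of_ae ((Lp.coeFn_nonneg p).2 hp)

theorem norm_eq_integral_of_nonneg {p : L1 L} (hp : 0 ≤ p) : ‖p‖ = ∫ x in Ioo 0 L, p x := by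
  rw [L1.norm_eq_integral_norm]
  refine integral_congr_ae ?_
  filter_upwards [(Lp.coeFn_nonneg p).2 hp] with x hx
  exact Real.norm_of_nonneg hx

theorem integral_mul_nonneg_of_nonneg (hμ : IsRepairRate L N μ) {p : L1 L} (hp : 0 ≤ p) :
    0 ≤ ∫ x in Ioo 0 L, μ x * p x := by
  refine integral_nonneg_of_ae ?_
  filter_upwards [(Lp.coeFn_nonneg p).2 hp, ae_restrict_mem measurableSet_Ioo] with x hx hx'
  exact mul_nonneg (hμ.nonneg x ⟨hx'.1.le, hx'.2⟩) hx

theorem smul_nonneg_of_nonneg {c : ℝ} (hc : 0 ≤ c) {p : L1 L} (hp : 0 ≤ p) : 0 ≤ c • p := by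
  rw [← Lp.coeFn_nonneg] at hp ⊢
  filter_upwards [hp, Lp.coeFn_smul c p] with x hx hx'
  rw [hx']
  exact mul_nonneg hc hx

/-- For a nonnegative homogeneous solution, repair and decay together cannot exceed the inflow a.
This yields κ > 0 in the resolvent. -/
theorem IsSolution.integral_mul_add_le (hL : 0 < L) (hμ : IsRepairRate L N μ) {c a : ℝ}
    (hc : 0 ≤ c) (ha : 0 ≤ a) {p : L1 L} (h : IsSolution μ c 0 p a) (hp : 0 ≤ p) :
    (∫ x in Ioo 0 L, μ x * p x) + c * ∫ x in Ioo 0 L, p x ≤ a := by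
  have := h.integral_mul_abs_add_le hL hμ hc
  rw [norm_zero, add_zero, abs_of_nonneg ha, norm_eq_integral_of_nonneg hp] at this
  linarith [abs_integral_mul_le hμ p, le_abs_self (∫ x in Ioo 0 L, μ x * p x)]

theorem integral_smul_add (s : ℝ) (p q : L1 L) :
    ∫ x in Ioo 0 L, (s • p + q : L1 L) x =
      s * (∫ x in Ioo 0 L, p x) + ∫ x in Ioo 0 L, q x := by
  rw [← integral_const_mul, ← integral_add ((L1.integrable_coeFn p).const_mul s)
    (L1.integrable_coeFn q)]
  refine integral_congr_ae ?_
  filter_upwards [Lp.coeFn_add (s • p) q, Lp.coeFn_smul s p] with x h1 h2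
  rw [h1, Pi.add_apply, h2, Pi.smul_apply, smul_eq_mul]

theorem exists_resolvent (hL : 0 < L) (hlam₁ : 0 < lam₁) (hlam₂ : 0 < lam₂)
    (hμ₁ : IsRepairRate L N μ₁) (hμ₂ : IsRepairRate L N μ₂) {γ : ℝ} (hγ : 0 < γ)
    (y : StateSpace L) :
    ∃ x : (systemOperator L lam₁ lam₂ μ₁ μ₂).domain,
      γ • (x : StateSpace L) - systemOperator L lam₁ lam₂ μ₁ μ₂ x = y ∧
      (y.Nonneg → StateSpace.Nonneg (x : StateSpace L)) := by
  have hγ₂ : 0 ≤ γ + lam₂ := by positivity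
  obtain ⟨φ₁, hφ₁, hφ₁'⟩ := exists_isSolution hL hμ₁ hγ₂ 0 1
  obtain ⟨φ₂, hφ₂, hφ₂'⟩ := exists_isSolution hL hμ₂ hγ.le 0 1
  obtain ⟨r₁, hr₁, hr₁'⟩ := exists_isSolution hL hμ₁ hγ₂ y.snd.fst 0
  obtain ⟨r₂, hr₂, hr₂'⟩ := exists_isSolution hL hμ₂ hγ.le y.snd.snd 0
  have hφ₁0 := hφ₁' zero_le_one le_rfl
  have hφ₂0 := hφ₂' zero_le_one le_rfl
  have hA1 := integral_mul_nonneg_of_nonneg hμ₁ hφ₁0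
  have hA2 := integral_mul_nonneg_of_nonneg hμ₂ hφ₂0
  have hB1 := integral_nonneg_of_nonneg hφ₁0
  have hB2 := integral_nonneg_of_nonneg hφ₂0
  have hm1 := hφ₁.integral_mul_add_le hL hμ₁ hγ₂ zero_le_one hφ₁0
  have hm2 := hφ₂.integral_mul_add_le hL hμ₂ hγ.le zero_le_one hφ₂0
  set A1 := ∫ x in Ioo 0 L, μ₁ x * φ₁ x
  set A2 := ∫ x in Ioo 0 L, μ₂ x * φ₂ x
  set B1 := ∫ x in Ioo 0 L, φ₁ x
  -- With p₁ = lam₁p₀φ₁ + r₁ and p₂ = p₂(0)φ₂ + r₂, κ collects the coefficients of p₀ in the first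
  -- equation and η below the remaining terms. From A2 ≤ 1 and A1 + (γ + lam₂)B1 ≤ 1 follows κ ≥ γ +
  -- lam₁γB1 > 0.
  set κ := γ + lam₁ + lam₂ - lam₁ * A1 - (lam₂ + lam₂ * (lam₁ * B1)) * A2 with hκ
  have hκ0 : 0 < κ := by
    have h1 : A2 ≤ 1 := by nlinarith
    have h2 : lam₂ * (lam₁ * B1) * A2 ≤ lam₂ * (lam₁ * B1) :=
      mul_le_of_le_one_right (by positivity) h1
    have h3 : lam₂ * A2 ≤ lam₂ := mul_le_of_le_one_right hlam₂.le h1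
    have h4 : lam₁ * (A1 + (γ + lam₂) * B1) ≤ lam₁ := mul_le_of_le_one_right hlam₁.le hm1
    have h5 : 0 ≤ lam₁ * (γ * B1) := by positivity
    nlinarith
  set η := y.fst + (∫ x in Ioo 0 L, μ₁ x * r₁ x) + (∫ x in Ioo 0 L, μ₂ x * r₂ x) +
    lam₂ * (∫ x in Ioo 0 L, r₁ x) * A2 with hη
  set p₀ := η / κ with hp₀
  have hp₀κ : κ * p₀ = η := mul_div_cancel₀ _ hκ0.ne'
  set p₁ : L1 L := (lam₁ * p₀) • φ₁ + r₁ with hp₁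
  set a₂ := lam₂ * p₀ + lam₂ * ∫ x in Ioo 0 L, p₁ x with ha₂
  set p₂ : L1 L := a₂ • φ₂ + r₂ with hp₂
  have hs₁ : IsSolution μ₁ (γ + lam₂) y.snd.fst p₁ (lam₁ * p₀) := by
    simpa using (hφ₁.smul (lam₁ * p₀)).add hr₁
  have hs₂ : IsSolution μ₂ γ y.snd.snd p₂ a₂ := by
    simpa using (hφ₂.smul a₂).add hr₂
  have i1 : ∫ x in Ioo 0 L, μ₁ x * p₁ x = lam₁ * p₀ * A1 + ∫ x in Ioo 0 L, μ₁ x * r₁ x := by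
    rw [hp₁, integral_mul_add (Submodule.smul_mem _ _ hφ₁.mem_mulDomain) hr₁.mem_mulDomain,
      integral_mul_smul]
  have i2 : ∫ x in Ioo 0 L, μ₂ x * p₂ x = a₂ * A2 + ∫ x in Ioo 0 L, μ₂ x * r₂ x := by
    rw [hp₂, integral_mul_add (Submodule.smul_mem _ _ hφ₂.mem_mulDomain) hr₂.mem_mulDomain,
      integral_mul_smul]
  have i3 : ∫ x in Ioo 0 L, p₁ x = lam₁ * p₀ * B1 + ∫ x in Ioo 0 L, r₁ x :=
    integral_smul_add _ _ _
  have hs₀ : (γ + lam₁ + lam₂) * p₀ - (∫ t in Ioo 0 L, μ₁ t * p₁ t)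
      - (∫ t in Ioo 0 L, μ₂ t * p₂ t) = y.fst := by
    rw [i1, i2, ha₂, i3]
    rw [hκ, hη] at hp₀κ
    linear_combination hp₀κ
  obtain ⟨h, hxy⟩ := resolvent_eq_iff.2
    (⟨hs₁, hs₂, hs₀⟩ :
      IsSolution μ₁ (γ + lam₂) y.snd.fst (StateSpace.mk p₀ p₁ p₂).snd.fst
        (lam₁ * (StateSpace.mk p₀ p₁ p₂).fst) ∧
      IsSolution μ₂ γ y.snd.snd (StateSpace.mk p₀ p₁ p₂).snd.snd
        (lam₂ * (StateSpace.mk p₀ p₁ p₂).fst +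
          lam₂ * ∫ t in Ioo 0 L, (StateSpace.mk p₀ p₁ p₂).snd.fst t) ∧ _)
  refine ⟨⟨_, h⟩, hxy, fun ⟨y0, y1, y2⟩ => ?_⟩
  have hr₁0 := hr₁' le_rfl y1
  have hr₂0 := hr₂' le_rfl y2
  have n1 := integral_mul_nonneg_of_nonneg hμ₁ hr₁0
  have n2 := integral_mul_nonneg_of_nonneg hμ₂ hr₂0
  have n3 := integral_nonneg_of_nonneg hr₁0
  have hp₀0 : 0 ≤ p₀ := div_nonneg (by positivity) hκ0.le
  have hp₁0 : 0 ≤ p₁ := add_nonneg (smul_nonneg_of_nonneg (by positivity) hφ₁0) hr₁0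
  have n4 := integral_nonneg_of_nonneg hp₁0
  exact ⟨hp₀0, hp₁0, add_nonneg (smul_nonneg_of_nonneg (by positivity) hφ₂0) hr₂0⟩

/-! ### The positive cone -/

/-- The positive cone of `X`. -/
def positiveCone (L : ℝ) : ConvexCone ℝ (StateSpace L) where
  carrier := {p | p.Nonneg}
  smul_mem' := fun _ hc _ ⟨h0, h1, h2⟩ =>
    ⟨mul_nonneg hc.le h0, smul_nonneg_of_nonneg hc.le h1, smul_nonneg_of_nonneg hc.le h2⟩
  add_mem' := fun _ ⟨h0, h1, h2⟩ _ ⟨k0, k1, k2⟩ =>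
    ⟨add_nonneg h0 k0, add_nonneg h1 k1, add_nonneg h2 k2⟩

theorem mem_positiveCone {p : StateSpace L} : p ∈ positiveCone L ↔ p.Nonneg := Iff.rfl

theorem zero_mem_positiveCone (L : ℝ) : (0 : StateSpace L) ∈ positiveCone L :=
  ⟨le_rfl, le_rfl, le_rfl⟩

theorem isClosed_positiveCone (L : ℝ) : IsClosed (positiveCone L : Set (StateSpace L)) := by
  have h0 : IsClosed {p : StateSpace L | 0 ≤ p.fst} :=
    isClosed_le continuous_const (by fun_prop)
  have h1 : IsClosed {p : StateSpace L | 0 ≤ p.snd.fst} :=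
    isClosed_le continuous_const (by fun_prop)
  have h2 : IsClosed {p : StateSpace L | 0 ≤ p.snd.snd} :=
    isClosed_le continuous_const (by fun_prop)
  exact h0.inter (h1.inter h2)

end RepairableSystem

theorem theorem2p1 (L lam₁ lam₂ : ℝ) (μ₁ μ₂ : ℝ → ℝ) (N : ℕ)
    (hL : 0 < L) (hlam₁ : 0 < lam₁) (hlam₂ : 0 < lam₂) (hN : 0 < N)
    (hμ₁ : RepairableSystem.IsRepairRate L N μ₁)
    (hμ₂ : RepairableSystem.IsRepairRate L N μ₂) :
    ∃ T : C0Semigroup (RepairableSystem.StateSpace L),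
      T.generator = RepairableSystem.systemOperator L lam₁ lam₂ μ₁ μ₂ ∧
      (∀ t : NNReal, ‖T.op t‖ ≤ 1) ∧
      (∀ (t : NNReal) (p : RepairableSystem.StateSpace L),
        RepairableSystem.StateSpace.Nonneg p →
          RepairableSystem.StateSpace.Nonneg (T.op t p)) := by
  have hdiss := fun (γ : ℝ) (hγ : 0 < γ) =>
    RepairableSystem.systemOperator_dissipative hL hlam₁ hlam₂ hμ₁ hμ₂ hγ
  have hres := fun (γ : ℝ) (hγ : 0 < γ) =>
    RepairableSystem.exists_resolvent hL hlam₁ hlam₂ hμ₁ hμ₂ hγ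
  have hcone : ∀ γ : ℝ, 0 < γ →
      ∀ x : (RepairableSystem.systemOperator L lam₁ lam₂ μ₁ μ₂).domain,
        γ • x.1 - RepairableSystem.systemOperator L lam₁ lam₂ μ₁ μ₂ x ∈
          RepairableSystem.positiveCone L → x.1 ∈ RepairableSystem.positiveCone L := by
    intro γ hγ x hx
    -- Positivity is known for the constructed solution x'; uniqueness by dissipativity transfers it
    -- to x.
    obtain ⟨x', hx', h⟩ := hres γ hγ
      (γ • x.1 - RepairableSystem.systemOperator L lam₁ lam₂ μ₁ μ₂ x)
    rw [← LinearPMap.eq_of_dissipative hγ (hdiss γ hγ) hx']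
    exact RepairableSystem.mem_positiveCone.2 (h (RepairableSystem.mem_positiveCone.1 hx))
  obtain ⟨T, hT, hT1, hpos⟩ := C0Semigroup.exists_of_dissipative
    (RepairableSystem.systemOperator L lam₁ lam₂ μ₁ μ₂)
    (RepairableSystem.dense_systemDomain hL hμ₁ hμ₂) hdiss
    (fun γ hγ y => (hres γ hγ y).imp fun _ h => h.1) (RepairableSystem.positiveCone L)
    (RepairableSystem.isClosed_positiveCone L) (RepairableSystem.zero_mem_positiveCone L) hcone
  exact ⟨T, hT, hT1, fun t p hp =>
    RepairableSystem.mem_positiveCone.1 (hpos t p (RepairableSystem.mem_positiveCone.2 hp))⟩
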